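/- **Setting.** $\mathcal S_0(\mathbb R)$ is the space of Schwartz functions $\varphi$ on $\mathbb R$ with $\int x^k\varphi(x)\,dx=0$ for all $k\in\mathbb N_0$, with the topology induced by $\mathcal S(\mathbb R)$, and $\mathcal S_0'(\mathbb R)$ is its dual. A function $L$ is slowly varying at $0$ if it is positive and measurable on some $(0,A]$, $A>0$, and $L(a\varepsilon)/L(\varepsilon)\to1$ as $\varepsilon\to0^+$ for each $a>0$. For $f,u\in\mathcal S_0'(\mathbb R)$, $m\in\mathbb R$, we write $f(\varepsilon x)\sim\varepsilon^mL(\varepsilon)u(x)$ in $\mathcal S_0'(\mathbb R)$ if $\langle f(\varepsilon x),\varphi(x)\rangle/(\varepsilon^mL(\varepsilon))\to\langle u,\varphi\rangle$ as $\varepsilon\to0^+$ for every $\varphi\in\mathcal S_0(\mathbb R)$. For $\alpha\in\mathbb R$ with $\sin\alpha\ne0$ put $c_1=\cot\alpha$, $c_2=\csc\alpha$. For a Schwartz function $h$, $x\in\mathbb R$, $\xi>0$, the fractional wavelet transform of $f$ is $$W_h^\alpha f(x,\xi)=\frac1{\sqrt\xi}\Big\langle f(t),\ \overline{h\big(\tfrac{t-x}{\xi}\big)}\,e^{ic_1(t^2-x^2)/2}\Big\rangle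 ,$$ where, if $f\in\mathcal S_0'(\mathbb R)$, the pairing is taken with an extension of $f$ to a tempered distribution (one exists by Hahn–Banach). For $u\in\mathcal S_0'(\mathbb R)$, $g\in\mathcal S_0(\mathbb R)$, the wavelet transform is $W_gu(x,\xi)=\xi^{-1/2}\langle u(t),\overline{g((t-x)/\xi)}\rangle$. Write $M_ah(t)=e^{iat}h(t)$ and $h_a(t)=h(at)$. $\mathcal S_0(\mathbb R\times\mathbb R^+)$ is the space of smooth $\Phi$ on $\mathbb R\times(0,\infty)$ with $\sup_{x\in\mathbb R,\,\xi>0}(\xi^s+\xi^{-s})\,|x^r\partial_\xi^l\partial_x^n\Phi(x,\xi)|<\infty$ for all $l,n,s,r\in\mathbb N_0$; functions $H$ on $\mathbb R\times(0,\infty)$ act on it by $\int_0^\infty\!\int_{\mathbb R} H\,\Phi\,dx\,d\xi$. **Theorem.** Let $f\in\mathcal S_0'(\mathbb R)$ satisfy $f(\varepsilon x)\sim\varepsilon^mL(\varepsilon)u(x)$ as $\varepsilon\to0^+$ in $\mathcal S_0'(\mathbb R)$, where $m\in\mathbb R$, $L$ is slowly varying at $0$ and $u\in\mathcal S_0'(\mathbb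 R)$. Let $g\in\mathcal S_0(\mathbb R)\setminus\{0\}$ and $\alpha\in(2k\pi,(2k+\tfrac12)\pi)$ for some $k\in\mathbb Z$. Then, for every choice of the tempered extension of $f$, $$e^{ic_1(\varepsilon x)^2/2-ic_2\varepsilon^2x\xi}\;W^\alpha_{M_{c_2}g_{1/\varepsilon^2}}f\Big(\varepsilon x,\frac1{\varepsilon\xi}\Big)\ \sim\ \frac{\varepsilon^{m+3/2}}{c_2^{\,m+1/2}}\,L(\varepsilon)\;W_gu\Big(xc_2,\frac{c_2}{\xi}\Big)\qquad(\varepsilon\to0^+).$$ This holds in the weak topology of $\mathcal S_0'(\mathbb R\times\mathbb R^+)$: both sides, without the factor $\varepsilon^{m+3/2}L(\varepsilon)$ on the right, are absolutely integrable against every $\Phi\in\mathcal S_0(\mathbb R\times\mathbb R^+)$ (the left side for every $\varepsilon>0$), and the left side divided by $\varepsilon^{m+3/2}L(\varepsilon)$, paired with $\Phi$, converges to $c_2^{-(m+1/2)}W_gu(xc_2,c_2/\xi)$ paired with $\Phi$. It also holds pointwise, for each fixed $x\in\mathbb R$ and $\xi>0$. -/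

import Mathlib

open MeasureTheory Filter Topology Set
open scoped SchwartzMap ContDiff

noncomputable section

/-! ### Operators on the Schwartz space -/

/-- The chirp `t ↦ exp (i (a + b t + c t²))`. -/
def chirp (a b c : ℝ) (t : ℝ) : ℂ := Complex.exp (((a + b * t + c * t ^ 2 : ℝ) : ℂ) * Complex.I)

theorem hasTemperateGrowth_cexp_ofReal_mul_I :
    Function.HasTemperateGrowth (fun t : ℝ => Complex.exp ((t : ℂ) * Complex.I)) := by
  have hderiv : ∀ n : ℕ, iteratedDeriv n (fun t : ℝ => Complex.exp ((t : ℂ) * Complex.I)) =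
      fun t : ℝ => Complex.I ^ n * Complex.exp ((t : ℂ) * Complex.I) := by
    intro n
    induction n with
    | zero => simp
    | succ n ih =>
      rw [iteratedDeriv_succ, ih]
      funext t
      have h1 : HasDerivAt (fun t : ℝ => (t : ℂ) * Complex.I) (1 * Complex.I) t :=
        (Complex.ofRealCLM.hasDerivAt (x := t)).mul_const Complex.I
      have h2 := (h1.cexp).const_mul (Complex.I ^ n)
      rw [h2.deriv]
      ring
  refine ⟨?_, fun n => ⟨0, 1, fun t => ?_⟩⟩
  · exact (Complex.ofRealCLM.contDiff.mul contDiff_const).cexp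
  · rw [norm_iteratedFDeriv_eq_norm_iteratedDeriv, hderiv]
    simp [Complex.norm_exp_ofReal_mul_I]

theorem chirp_hasTemperateGrowth (a b c : ℝ) : (chirp a b c).HasTemperateGrowth := by
  have hid : Function.HasTemperateGrowth (fun t : ℝ => t) := Function.HasTemperateGrowth.id'
  have hp : Function.HasTemperateGrowth (fun t : ℝ => a + b * t + c * t ^ 2) :=
    ((Function.HasTemperateGrowth.const a).add
      ((Function.HasTemperateGrowth.const b).mul hid)).add
      ((Function.HasTemperateGrowth.const c).mul (hid.pow 2))
  exact hasTemperateGrowth_cexp_ofReal_mul_I.comp hp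

/-- Multiplication of a Schwartz function by the chirp `exp (i (a + b t + c t²))`. -/
def chirpMul (a b c : ℝ) : 𝓢(ℝ, ℂ) →L[ℂ] 𝓢(ℝ, ℂ) := SchwartzMap.smulLeftCLM ℂ (chirp a b c)

theorem chirpMul_apply (a b c : ℝ) (φ : 𝓢(ℝ, ℂ)) (t : ℝ) :
    chirpMul a b c φ t =
      Complex.exp (((a + b * t + c * t ^ 2 : ℝ) : ℂ) * Complex.I) * φ t := by
  rw [chirpMul, SchwartzMap.smulLeftCLM_apply_apply (chirp_hasTemperateGrowth a b c)]
  rfl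

/-- The modulation `(M_a φ)(t) = exp (i a t) φ(t)`. -/
def modulate (a : ℝ) : 𝓢(ℝ, ℂ) →L[ℂ] 𝓢(ℝ, ℂ) := chirpMul 0 a 0

theorem modulate_apply (a : ℝ) (φ : 𝓢(ℝ, ℂ)) (t : ℝ) :
    modulate a φ t = Complex.exp (((a * t : ℝ) : ℂ) * Complex.I) * φ t := by
  rw [modulate, chirpMul_apply]
  simp

/-- The dilation `φ_a(t) = φ(a t)` for `a ≠ 0` (and `0` for the irrelevant value `a = 0`). -/
def dilate (a : ℝ) : 𝓢(ℝ, ℂ) →L[ℂ] 𝓢(ℝ, ℂ) :=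
  if h : a ≠ 0 then
    SchwartzMap.compCLMOfContinuousLinearEquiv ℂ
      (ContinuousLinearEquiv.unitsEquivAut ℝ (Units.mk0 a h))
  else 0

theorem dilate_apply {a : ℝ} (ha : a ≠ 0) (φ : 𝓢(ℝ, ℂ)) (t : ℝ) : dilate a φ t = φ (a * t) := by
  simp [dilate, ha, mul_comm]

theorem dilate_zero : dilate 0 = 0 := by simp [dilate]

/-- The pointwise complex conjugate of a Schwartz function. -/
def conjSchwartz : 𝓢(ℝ, ℂ) →L[ℝ] 𝓢(ℝ, ℂ) :=
  SchwartzMap.postcompCLM (Complex.conjCLE : ℂ →L[ℝ] ℂ)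

theorem conjSchwartz_apply (φ : 𝓢(ℝ, ℂ)) (t : ℝ) :
    conjSchwartz φ t = (starRingEnd ℂ) (φ t) := by
  simp [conjSchwartz]

/-- The function `t ↦ conj (g ((t - x) / ξ))`, for `ξ ≠ 0`. -/
def wavelet (g : 𝓢(ℝ, ℂ)) (x ξ : ℝ) : 𝓢(ℝ, ℂ) :=
  conjSchwartz (SchwartzMap.compSubConstCLM ℂ x (dilate ξ⁻¹ g))

theorem wavelet_apply (g : 𝓢(ℝ, ℂ)) (x : ℝ) {ξ : ℝ} (hξ : ξ ≠ 0) (t : ℝ) :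
    wavelet g x ξ t = (starRingEnd ℂ) (g ((t - x) / ξ)) := by
  rw [wavelet, conjSchwartz_apply, SchwartzMap.compSubConstCLM_apply,
    dilate_apply (inv_ne_zero hξ), inv_mul_eq_div]

/-! ### The Lizorkin space and its dual -/

theorem integrable_pow_mul_schwartz (φ : 𝓢(ℝ, ℂ)) (k : ℕ) :
    Integrable (fun x : ℝ => (x : ℂ) ^ k * φ x) := by
  have h := φ.integrable_pow_mul (μ := volume) k
  refine h.mono' (by fun_prop) (Eventually.of_forall fun x => ?_)
  simp

/-- The space `S₀(ℝ)` of Schwartz functions all of whose moments vanish, with the topology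
induced by `S(ℝ)`. -/
def LizorkinSpace : Submodule ℂ 𝓢(ℝ, ℂ) where
  carrier := {φ | ∀ k : ℕ, ∫ x : ℝ, (x : ℂ) ^ k * φ x = 0}
  zero_mem' := by intro k; simp
  add_mem' := by
    intro φ ψ hφ hψ k
    have hh : ∀ x : ℝ, (x : ℂ) ^ k * (φ + ψ) x = (x : ℂ) ^ k * φ x + (x : ℂ) ^ k * ψ x := by
      intro x; simp [mul_add]
    simp_rw [hh]
    rw [integral_add (integrable_pow_mul_schwartz φ k) (integrable_pow_mul_schwartz ψ k),
      hφ k, hψ k, add_zero]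
  smul_mem' := by
    intro c φ hφ k
    have hh : ∀ x : ℝ, (x : ℂ) ^ k * (c • φ) x = c * ((x : ℂ) ^ k * φ x) := by
      intro x; simp; ring
    simp_rw [hh]
    rw [integral_const_mul, hφ k, mul_zero]

/-- The space `S₀'(ℝ)` of Lizorkin distributions. -/
abbrev LizorkinDistribution := LizorkinSpace →L[ℂ] ℂ

theorem mem_lizorkinSpace {φ : 𝓢(ℝ, ℂ)} :
    φ ∈ LizorkinSpace ↔ ∀ k : ℕ, ∫ x : ℝ, (x : ℂ) ^ k * φ x = 0 := Iff.rfl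

theorem dilate_mem {φ : 𝓢(ℝ, ℂ)} (hφ : φ ∈ LizorkinSpace) (a : ℝ) :
    dilate a φ ∈ LizorkinSpace := by
  rcases eq_or_ne a 0 with rfl | ha
  · rw [dilate_zero]; exact LizorkinSpace.zero_mem
  · intro k
    have hh : ∀ x : ℝ, (x : ℂ) ^ k * dilate a φ x =
        ((a : ℂ) ^ k)⁻¹ * (fun y : ℝ => (y : ℂ) ^ k * φ y) (a * x) := by
      intro x
      have ha' : (a : ℂ) ≠ 0 := by exact_mod_cast ha
      simp only [dilate_apply ha, Complex.ofReal_mul, mul_pow]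
      field_simp
    rw [integral_congr_ae (Eventually.of_forall hh), integral_const_mul,
      Measure.integral_comp_mul_left (fun y : ℝ => (y : ℂ) ^ k * φ y) a, hφ k]
    simp

theorem compSubConst_mem {φ : 𝓢(ℝ, ℂ)} (hφ : φ ∈ LizorkinSpace) (x : ℝ) :
    SchwartzMap.compSubConstCLM ℂ x φ ∈ LizorkinSpace := by
  intro k
  have hh : ∀ t : ℝ, (t : ℂ) ^ k * SchwartzMap.compSubConstCLM ℂ x φ t =
      (fun s : ℝ => ((s + x : ℝ) : ℂ) ^ k * φ s) (t - x) := by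
    intro t; simp
  simp_rw [hh]
  rw [integral_sub_right_eq_self (fun s : ℝ => ((s + x : ℝ) : ℂ) ^ k * φ s) x]
  have hexp : ∀ s : ℝ, ((s + x : ℝ) : ℂ) ^ k * φ s =
      ∑ j ∈ Finset.range (k + 1), ((x : ℂ) ^ (k - j) * (k.choose j : ℂ)) * ((s : ℂ) ^ j * φ s) := by
    intro s
    rw [Complex.ofReal_add, add_pow, Finset.sum_mul]
    exact Finset.sum_congr rfl fun j _ => by ring
  simp_rw [hexp]
  rw [integral_finsetSum _ fun j _ => (integrable_pow_mul_schwartz φ j).const_mul _]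
  exact Finset.sum_eq_zero fun j _ => by rw [integral_const_mul, hφ j, mul_zero]

theorem conjSchwartz_mem {φ : 𝓢(ℝ, ℂ)} (hφ : φ ∈ LizorkinSpace) :
    conjSchwartz φ ∈ LizorkinSpace := by
  intro k
  have hh : ∀ t : ℝ, (t : ℂ) ^ k * conjSchwartz φ t = (starRingEnd ℂ) ((t : ℂ) ^ k * φ t) := by
    intro t; simp [conjSchwartz_apply]
  simp_rw [hh]
  rw [integral_conj, hφ k, map_zero]

theorem wavelet_mem {g : 𝓢(ℝ, ℂ)} (hg : g ∈ LizorkinSpace) (x ξ : ℝ) :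
    wavelet g x ξ ∈ LizorkinSpace :=
  conjSchwartz_mem (compSubConst_mem (dilate_mem hg _) _)

/-- `f(a x)` for `f ∈ S₀'(ℝ)` and `a > 0`: `⟨f(a x), φ(x)⟩ = a⁻¹ ⟨f(x), φ(x / a)⟩`. -/
def LizorkinDistribution.dilation (f : LizorkinDistribution) (a : ℝ) (φ : LizorkinSpace) : ℂ :=
  (a : ℂ)⁻¹ * f ⟨dilate a⁻¹ φ, dilate_mem φ.2 _⟩

/-- The tempered distribution `F` is an extension of `f ∈ S₀'(ℝ)` to `S(ℝ)`. -/
def IsTemperedExtension (F : 𝓢'(ℝ, ℂ)) (f : LizorkinDistribution) : Prop :=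
  ∀ φ : LizorkinSpace, F φ = f φ

/-- Every Lizorkin distribution has a tempered extension (Hahn-Banach). -/
theorem exists_isTemperedExtension (f : LizorkinDistribution) :
    ∃ F : 𝓢'(ℝ, ℂ), IsTemperedExtension F f := by
  have : PolynormableSpace ℂ 𝓢(ℝ, ℂ) := (schwartz_withSeminorms ℂ ℝ ℂ).toPolynormableSpace
  obtain ⟨F, hF⟩ := StrongDual.exists_extension LizorkinSpace f
  exact ⟨ContinuousLinearMap.toPointwiseConvergenceCLM _ _ _ _ F, fun φ => hF φ⟩

/-! ### Quasiasymptotics -/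

/-- Slow variation at the origin: `L` is defined, positive and (Lebesgue) measurable on some
`(0, A]`, and `L(a ε) / L(ε) → 1` as `ε → 0⁺` for each `a > 0`. -/
def SlowlyVaryingAtZero (L : ℝ → ℝ) : Prop :=
  (∃ A : ℝ, 0 < A ∧ (∀ ε ∈ Ioc 0 A, 0 < L ε) ∧ AEMeasurable L (volume.restrict (Ioc 0 A))) ∧
    ∀ a : ℝ, 0 < a → Tendsto (fun ε => L (a * ε) / L ε) (𝓝[>] 0) (𝓝 1)

/-- `f(ε x) ∼ ε^m L(ε) u(x)` as `ε → 0⁺` in `S₀'(ℝ)`. -/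
def HasQuasiasymptotics (f : LizorkinDistribution) (m : ℝ) (L : ℝ → ℝ)
    (u : LizorkinDistribution) : Prop :=
  ∀ φ : LizorkinSpace,
    Tendsto (fun ε : ℝ => f.dilation ε φ / ((ε ^ m * L ε : ℝ) : ℂ)) (𝓝[>] 0) (𝓝 (u φ))

/-! ### The wavelet transform and the fractional wavelet transform -/

/-- The fractional wavelet transform
`W_g^α F(x, ξ) = ξ^(-1/2) ⟨F(t), conj (g ((t - x) / ξ)) exp (i cot α (t² - x²) / 2)⟩`, `ξ > 0`,
of a tempered distribution `F` with respect to the window `g`. -/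
def frwt (α : ℝ) (g : 𝓢(ℝ, ℂ)) (F : 𝓢'(ℝ, ℂ)) (x ξ : ℝ) : ℂ :=
  ((√ξ : ℝ) : ℂ)⁻¹ *
    F (chirpMul (-(Real.cot α * x ^ 2 / 2)) 0 (Real.cot α / 2) (wavelet g x ξ))

/-- The wavelet transform `W_g u(x, ξ) = ξ^(-1/2) ⟨u(t), conj (g ((t - x) / ξ))⟩`, `ξ > 0`,
of `u ∈ S₀'(ℝ)` with respect to the window `g ∈ S₀(ℝ)`. -/
def waveletTransform (g : LizorkinSpace) (u : LizorkinDistribution) (x ξ : ℝ) : ℂ :=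
  ((√ξ : ℝ) : ℂ)⁻¹ * u ⟨wavelet g x ξ, wavelet_mem g.2 x ξ⟩

/-! ### Distributions on the half plane -/

/-- Membership of `(x, ξ) ↦ Φ x ξ` in `S₀(ℝ × ℝ⁺)`: `Φ` is smooth on `ℝ × (0, ∞)` and
`(ξ^s + ξ^(-s)) |x^r ∂_ξ^l ∂_x^n Φ(x, ξ)|` is bounded there for all `l, n, s, r ∈ ℕ`.
The values for `ξ ≤ 0` are irrelevant. -/
structure IsHalfPlaneTest (Φ : ℝ → ℝ → ℂ) : Prop where
  smooth : ContDiffOn ℝ ∞ (fun p : ℝ × ℝ => Φ p.1 p.2) (univ ×ˢ Ioi 0)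
  decay : ∀ l n s r : ℕ, ∃ C : ℝ, ∀ x ξ : ℝ, 0 < ξ →
    (ξ ^ s + (ξ ^ s)⁻¹) *
      ‖(x : ℂ) ^ r * iteratedDeriv l (fun η => iteratedDeriv n (fun y => Φ y η) x) ξ‖ ≤ C

/-- The pairing `∫∫ H(x, ξ) Φ(x, ξ) dx dξ` over `ℝ × (0, ∞)`. -/
def halfPlanePairing (H Φ : ℝ → ℝ → ℂ) : ℂ :=
  ∫ p in (univ : Set ℝ) ×ˢ Ioi (0 : ℝ), H p.1 p.2 * Φ p.1 p.2

/-- The pairing of `H` with every element of `S₀(ℝ × ℝ⁺)` is an absolutely convergent integral. -/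
def HalfPlanePairable (H : ℝ → ℝ → ℂ) : Prop :=
  ∀ Φ : ℝ → ℝ → ℂ, IsHalfPlaneTest Φ →
    IntegrableOn (fun p : ℝ × ℝ => H p.1 p.2 * Φ p.1 p.2) ((univ : Set ℝ) ×ˢ Ioi (0 : ℝ))

/-- `H_ε(x, ξ) ∼ ρ(ε) B(x, ξ)` as `ε → 0⁺` in (the weak topology of) `S₀'(ℝ × ℝ⁺)`, where the
functions `H_ε` (`ε > 0`) and `B` are paired with test functions by integration. -/
def AsymptoticInHalfPlaneDual (H : ℝ → ℝ → ℝ → ℂ) (ρ : ℝ → ℝ) (B : ℝ → ℝ → ℂ) : Prop :=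
  (∀ ε : ℝ, 0 < ε → HalfPlanePairable (H ε)) ∧ HalfPlanePairable B ∧
    ∀ Φ : ℝ → ℝ → ℂ, IsHalfPlaneTest Φ →
      Tendsto (fun ε : ℝ => halfPlanePairing (H ε) Φ / (ρ ε : ℂ)) (𝓝[>] 0)
        (𝓝 (halfPlanePairing B Φ))

/-- `H_ε(x, ξ) ∼ ρ(ε) B(x, ξ)` as `ε → 0⁺`, at every point of `ℝ × (0, ∞)`. -/
def AsymptoticPointwise (H : ℝ → ℝ → ℝ → ℂ) (ρ : ℝ → ℝ) (B : ℝ → ℝ → ℂ) : Prop :=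
  ∀ x ξ : ℝ, 0 < ξ → Tendsto (fun ε : ℝ => H ε x ξ / (ρ ε : ℂ)) (𝓝[>] 0) (𝓝 (B x ξ))

end

noncomputable section

/-! ### Schwartz seminorms on the line -/

/-! The window is scaled so that a change of variables turns the left side into `√(εξ)` times `F`
applied to the dilation by `ε⁻¹` of `exp(iε²(-c₂ξt + c₁t²/2))` times the wavelet `conj g(ξ(t - x))`;
the prefactor cancels every phase independent of `t` (`chirpMul_modulate_wavelet_eq`). As `ε → 0⁺`
the chirp tends to 1, so the limit should be `√ξ` times `u` at the wavelet. This is the stated right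
side, because a quasiasymptotic limit is homogeneous of degree `m`
(`HasQuasiasymptotics.homogeneous`, `waveletTransform_eq`).

The obstacle is that a chirped wavelet leaves `S₀(ℝ)`, where nothing is known about `f`. The chirp
is therefore expanded in powers of `ε²`. Polynomials times a wavelet stay in `S₀(ℝ)`, so the
hypothesis applies to every Taylor term, and only the zeroth survives. The remainder is `O(ε^(2N))`
in every Schwartz seminorm; the extension `F` has finite order, so the dilation costs only a fixed
power of `ε⁻¹`, and `L` is bounded below by a multiple of `ε²` (`SlowlyVaryingAtZero.exists_sq_le`).
A large `N` makes the remainder negligible for any extension (`exists_remainder_bound`).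

For the weak statement the estimates are made uniform in `(x, ξ)` up to a power of `(1 + |x|)(ξ +
ξ⁻¹)`, which test functions absorb. The Taylor terms are bounded by Banach–Steinhaus on the Fréchet
space `S₀(ℝ)` along sequences `ε_n → 0⁺` (`exists_scaledPairing_le`), and dominated convergence
concludes. -/

theorem SchwartzMap.seminorm_succ (k l : ℕ) (φ : 𝓢(ℝ, ℂ)) :
    SchwartzMap.seminorm ℂ k (l + 1) φ =
      SchwartzMap.seminorm ℂ k l (SchwartzMap.derivCLM ℂ ℂ φ) := by
  have h : ∀ x, iteratedDeriv (l + 1) φ x = iteratedDeriv l (SchwartzMap.derivCLM ℂ ℂ φ) x := by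
    intro x
    rw [iteratedDeriv_succ']
    rfl
  apply le_antisymm
  · refine SchwartzMap.seminorm_le_bound' ℂ _ _ _ (apply_nonneg _ _) fun x => ?_
    rw [h]
    exact SchwartzMap.le_seminorm' ℂ _ _ _ x
  · refine SchwartzMap.seminorm_le_bound' ℂ _ _ _ (apply_nonneg _ _) fun x => ?_
    rw [← h]
    exact SchwartzMap.le_seminorm' ℂ _ _ _ x

theorem SchwartzMap.seminorm_zero_le {k : ℕ} {φ : 𝓢(ℝ, ℂ)} {M : ℝ} (hM : 0 ≤ M)
    (h : ∀ t, |t| ^ k * ‖φ t‖ ≤ M) : SchwartzMap.seminorm ℂ k 0 φ ≤ M :=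
  SchwartzMap.seminorm_le_bound' ℂ _ _ _ hM (by simpa using h)

theorem SchwartzMap.le_seminorm_zero (k : ℕ) (φ : 𝓢(ℝ, ℂ)) (t : ℝ) :
    |t| ^ k * ‖φ t‖ ≤ SchwartzMap.seminorm ℂ k 0 φ := by
  simpa using SchwartzMap.le_seminorm' ℂ k 0 φ t

/-- The increasing family of norms defining the topology of `S(ℝ)`. -/
def schwartzNorm (K : ℕ) : Seminorm ℂ 𝓢(ℝ, ℂ) :=
  (Finset.Iic (K, K)).sup (schwartzSeminormFamily ℂ ℝ ℂ)

theorem seminorm_le_schwartzNorm {k l K : ℕ} (hk : k ≤ K) (hl : l ≤ K) (φ : 𝓢(ℝ, ℂ)) :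
    SchwartzMap.seminorm ℂ k l φ ≤ schwartzNorm K φ := by
  have h : schwartzSeminormFamily ℂ ℝ ℂ (k, l) ≤ schwartzNorm K :=
    Finset.le_sup (f := schwartzSeminormFamily ℂ ℝ ℂ) (Finset.mem_Iic.2 (Prod.mk_le_mk.2 ⟨hk, hl⟩))
  exact h φ

theorem schwartzNorm_mono {K K' : ℕ} (h : K ≤ K') (φ : 𝓢(ℝ, ℂ)) :
    schwartzNorm K φ ≤ schwartzNorm K' φ := by
  have h' : schwartzNorm K ≤ schwartzNorm K' :=
    Finset.sup_mono (Finset.Iic_subset_Iic.2 (Prod.mk_le_mk.2 ⟨h, h⟩))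
  exact h' φ

theorem schwartzNorm_le {K : ℕ} {φ : 𝓢(ℝ, ℂ)} {M : ℝ} (hM : 0 ≤ M)
    (h : ∀ k ≤ K, ∀ l ≤ K, SchwartzMap.seminorm ℂ k l φ ≤ M) : schwartzNorm K φ ≤ M := by
  refine Seminorm.finset_sup_apply_le hM fun i hi => ?_
  have := Prod.mk_le_mk.1 (Finset.mem_Iic.1 hi)
  exact h i.1 this.1 i.2 this.2

/-- Reduces continuity to a bound by one norm of an increasing family, so that different bounds can
be merged by enlarging the index. -/
theorem Seminorm.exists_le_schwartzNorm (p : Seminorm ℂ 𝓢(ℝ, ℂ)) (hp : Continuous p) :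
    ∃ (K : ℕ) (C : ℝ), 0 ≤ C ∧ ∀ φ, p φ ≤ C * schwartzNorm K φ := by
  obtain ⟨s, C, -, h⟩ := Seminorm.bound_of_continuous (schwartz_withSeminorms ℂ ℝ ℂ) p hp
  refine ⟨s.sup (fun i => max i.1 i.2), C, C.2, fun φ => (h φ).trans ?_⟩
  rw [_root_.smul_apply, NNReal.smul_def, smul_eq_mul]
  refine mul_le_mul_of_nonneg_left ?_ C.2
  refine Seminorm.finset_sup_apply_le (apply_nonneg _ _) fun i hi => ?_
  have := Finset.le_sup (f := fun i : ℕ × ℕ => max i.1 i.2) hi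
  exact seminorm_le_schwartzNorm ((le_max_left _ _).trans this) ((le_max_right _ _).trans this) φ

theorem exists_norm_le_schwartzNorm {G : 𝓢(ℝ, ℂ) →ₗ[ℂ] ℂ} (hG : Continuous G) :
    ∃ (K : ℕ) (C : ℝ), 0 ≤ C ∧ ∀ φ, ‖G φ‖ ≤ C * schwartzNorm K φ :=
  Seminorm.exists_le_schwartzNorm ((normSeminorm ℂ ℂ).comp G) (continuous_norm.comp hG)

/-! ### Families of operators with polynomially bounded norms -/

/-- A family of operators on `S(ℝ)`, continuous with bounds that grow at most polynomially in the
weight `w`. -/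
def TameFamily {ι : Type*} (w : ι → ℝ) (A : ι → 𝓢(ℝ, ℂ) → 𝓢(ℝ, ℂ)) : Prop :=
  ∀ k l : ℕ, ∃ (K : ℕ) (C : ℝ) (b : ℕ), 0 ≤ C ∧
    ∀ i φ, SchwartzMap.seminorm ℂ k l (A i φ) ≤ C * w i ^ b * schwartzNorm K φ

section TameFamily

variable {ι : Type*} {w : ι → ℝ} {A B : ι → 𝓢(ℝ, ℂ) → 𝓢(ℝ, ℂ)}

/-- As `w ≥ 1` and the norms increase with `K`, finitely many bounds merge by taking the largest `K`
and `b` and the sum of the constants. -/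
theorem exists_common_bound (hw : ∀ i, 1 ≤ w i) {n : ℕ} {P : Fin n → ι → 𝓢(ℝ, ℂ) → ℝ}
    (h : ∀ j, ∃ (K : ℕ) (C : ℝ) (b : ℕ), 0 ≤ C ∧
      ∀ i φ, P j i φ ≤ C * w i ^ b * schwartzNorm K φ) :
    ∃ (K : ℕ) (C : ℝ) (b : ℕ), 0 ≤ C ∧ ∀ j i φ, P j i φ ≤ C * w i ^ b * schwartzNorm K φ := by
  choose K C b hC h using h
  refine ⟨Finset.univ.sup K, ∑ j, C j, Finset.univ.sup b, Finset.sum_nonneg fun j _ => hC j,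
    fun j i φ => (h j i φ).trans ?_⟩
  have h1 : K j ≤ Finset.univ.sup K := Finset.le_sup (Finset.mem_univ j)
  have h2 : b j ≤ Finset.univ.sup b := Finset.le_sup (Finset.mem_univ j)
  have h3 : C j ≤ ∑ j, C j := Finset.single_le_sum (fun j _ => hC j) (Finset.mem_univ j)
  have hw0 : 0 ≤ w i := zero_le_one.trans (hw i)
  have h4 := schwartzNorm_mono h1 φ
  have h5 := pow_le_pow_right₀ (hw i) h2
  have h6 : 0 ≤ ∑ j, C j := (hC j).trans h3
  gcongr

theorem TameFamily.schwartzNorm_le (hw : ∀ i, 1 ≤ w i) (hA : TameFamily w A) (K : ℕ) :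
    ∃ (K' : ℕ) (C : ℝ) (b : ℕ), 0 ≤ C ∧
      ∀ i φ, schwartzNorm K (A i φ) ≤ C * w i ^ b * schwartzNorm K' φ := by
  obtain ⟨K', C, b, hC, h⟩ := exists_common_bound (n := (K + 1) * (K + 1)) hw
    (P := fun j i φ => SchwartzMap.seminorm ℂ (finProdFinEquiv.symm j).1 (finProdFinEquiv.symm j).2
      (A i φ)) (fun j => hA _ _)
  refine ⟨K', C, b, hC, fun i φ => _root_.schwartzNorm_le ?_ fun k hk l hl => ?_⟩
  · have := zero_le_one.trans (hw i)
    positivity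
  · simpa using h (finProdFinEquiv (⟨k, Nat.lt_succ_of_le hk⟩, ⟨l, Nat.lt_succ_of_le hl⟩)) i φ

theorem TameFamily.comp (hw : ∀ i, 1 ≤ w i) (hA : TameFamily w A) (hB : TameFamily w B) :
    TameFamily w (fun i φ => A i (B i φ)) := by
  intro k l
  obtain ⟨K, C, b, hC, h⟩ := hA k l
  obtain ⟨K', C', b', hC', h'⟩ := hB.schwartzNorm_le hw K
  refine ⟨K', C * C', b + b', mul_nonneg hC hC', fun i φ => ?_⟩
  have hw0 : 0 ≤ w i := zero_le_one.trans (hw i)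
  calc _ ≤ C * w i ^ b * schwartzNorm K (B i φ) := h i _
    _ ≤ C * w i ^ b * (C' * w i ^ b' * schwartzNorm K' φ) := by gcongr; exact h' i φ
    _ = _ := by ring

theorem TameFamily.add (hw : ∀ i, 1 ≤ w i) (hA : TameFamily w A) (hB : TameFamily w B) :
    TameFamily w (fun i φ => A i φ + B i φ) := by
  intro k l
  obtain ⟨K, C, b, hC, h⟩ := exists_common_bound (n := 2) hw
    (P := fun j i φ => SchwartzMap.seminorm ℂ k l (![A, B] j i φ))
    (fun j => by fin_cases j; exacts [hA k l, hB k l])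
  refine ⟨K, 2 * C, b, by positivity, fun i φ => (map_add_le_add _ _ _).trans ?_⟩
  have h0 : SchwartzMap.seminorm ℂ k l (A i φ) ≤ _ := h 0 i φ
  have h1 : SchwartzMap.seminorm ℂ k l (B i φ) ≤ _ := h 1 i φ
  linarith

theorem TameFamily.smul (hw : ∀ i, 1 ≤ w i) (hA : TameFamily w A) {c : ι → ℂ}
    (hc : ∀ i, ‖c i‖ ≤ w i) : TameFamily w (fun i φ => c i • A i φ) := by
  intro k l
  obtain ⟨K, C, b, hC, h⟩ := hA k l
  refine ⟨K, C, b + 1, hC, fun i φ => ?_⟩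
  have hw0 : 0 ≤ w i := zero_le_one.trans (hw i)
  rw [map_smul_eq_mul]
  calc _ ≤ w i * (C * w i ^ b * schwartzNorm K φ) := by
        gcongr
        exacts [hc i, h i φ]
    _ = _ := by ring

theorem tameFamily_const (T : 𝓢(ℝ, ℂ) →L[ℂ] 𝓢(ℝ, ℂ)) : TameFamily w (fun _ φ => T φ) := by
  intro k l
  obtain ⟨K, C, hC, h⟩ := Seminorm.exists_le_schwartzNorm
    ((schwartzSeminormFamily ℂ ℝ ℂ (k, l)).comp T.toLinearMap)
    (((schwartz_withSeminorms ℂ ℝ ℂ).continuous_seminorm (k, l)).comp T.continuous)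
  exact ⟨K, C, 0, hC, fun i φ => by simpa using h φ⟩

theorem TameFamily.iterate (hw : ∀ i, 1 ≤ w i) (hA : TameFamily w A) (j : ℕ) :
    TameFamily w (fun i => (A i)^[j]) := by
  induction j with
  | zero => exact tameFamily_const (ContinuousLinearMap.id ℂ _)
  | succ j ih => simpa only [Function.iterate_succ'] using! hA.comp hw ih

/-- It is enough to bound the norms without derivatives when the derivative of `A i φ` is
`A i (B i φ)` for a tame family `B`. -/
theorem tameFamily_of_deriv (hw : ∀ i, 1 ≤ w i) (hB : TameFamily w B)
    (hD : ∀ i φ, SchwartzMap.derivCLM ℂ ℂ (A i φ) = A i (B i φ))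
    (h0 : ∀ k : ℕ, ∃ (K : ℕ) (C : ℝ) (b : ℕ), 0 ≤ C ∧
      ∀ i φ, SchwartzMap.seminorm ℂ k 0 (A i φ) ≤ C * w i ^ b * schwartzNorm K φ) :
    TameFamily w A := by
  intro k l
  induction l with
  | zero => exact h0 k
  | succ l ih =>
    obtain ⟨K, C, b, hC, h⟩ := ih
    obtain ⟨K', C', b', hC', h'⟩ := hB.schwartzNorm_le hw K
    refine ⟨K', C * C', b + b', mul_nonneg hC hC', fun i φ => ?_⟩
    have hw0 : 0 ≤ w i := zero_le_one.trans (hw i)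
    rw [SchwartzMap.seminorm_succ, hD]
    calc _ ≤ C * w i ^ b * schwartzNorm K (B i φ) := h i _
      _ ≤ C * w i ^ b * (C' * w i ^ b' * schwartzNorm K' φ) := by gcongr; exact h' i φ
      _ = _ := by ring

/-! ### Translations and dilations as tame families -/

theorem derivCLM_compSubConst (x : ℝ) (φ : 𝓢(ℝ, ℂ)) :
    SchwartzMap.derivCLM ℂ ℂ (SchwartzMap.compSubConstCLM ℂ x φ) =
      SchwartzMap.compSubConstCLM ℂ x (SchwartzMap.derivCLM ℂ ℂ φ) := by
  ext t
  have h : HasDerivAt (fun t => φ (t - x)) (deriv φ (t - x)) t :=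
    (φ.hasDerivAt (t - x)).comp_sub_const t x
  exact h.deriv

theorem derivCLM_dilate (a : ℝ) (φ : 𝓢(ℝ, ℂ)) :
    SchwartzMap.derivCLM ℂ ℂ (dilate a φ) =
      (a : ℂ) • dilate a (SchwartzMap.derivCLM ℂ ℂ φ) := by
  rcases eq_or_ne a 0 with rfl | ha
  · simp [dilate_zero]
  ext t
  have h : HasDerivAt (fun t => φ (a * t)) (a • deriv φ (a * t)) t := by
    have := (φ.hasDerivAt (a * t)).scomp t ((hasDerivAt_id t).const_mul a)
    simpa [Function.comp_def] using this
  have h2 : (dilate a φ : ℝ → ℂ) = fun t => φ (a * t) := funext (dilate_apply ha φ)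
  rw [SchwartzMap.derivCLM_apply, h2, h.deriv]
  simp [dilate_apply ha]

theorem tameFamily_compSubConst (hw : ∀ i, 1 ≤ w i) {x : ι → ℝ} (hx : ∀ i, |x i| ≤ w i) :
    TameFamily w (fun i φ => SchwartzMap.compSubConstCLM ℂ (x i) φ) := by
  refine tameFamily_of_deriv hw (B := fun _ φ => SchwartzMap.derivCLM ℂ ℂ φ) (tameFamily_const _)
    (fun i φ => derivCLM_compSubConst _ _) fun k => ⟨k, 4 ^ k, k, by positivity, fun i φ => ?_⟩
  have hw0 : 0 ≤ w i := zero_le_one.trans (hw i)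
  refine SchwartzMap.seminorm_zero_le (by positivity) fun t => ?_
  -- Moves the polynomial weight from `t` to `t - x`. This costs `2^k w^k`; the other factor `2^k`
  -- in `4^k` comes from the comparison of `(1 + |t|)^k` with seminorms.
  have h1 : |t| ≤ 2 * w i * (1 + |t - x i|) := by
    have := abs_add_le (t - x i) (x i)
    rw [sub_add_cancel] at this
    nlinarith [hw i, hx i, abs_nonneg (t - x i)]
  have h2 := SchwartzMap.one_add_le_sup_seminorm_apply (𝕜 := ℂ) (m := (k, k)) (le_refl k)
    (Nat.zero_le k) φ (t - x i)
  rw [norm_iteratedFDeriv_zero, Real.norm_eq_abs] at h2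
  calc |t| ^ k * ‖φ (t - x i)‖ ≤ (2 * w i * (1 + |t - x i|)) ^ k * ‖φ (t - x i)‖ := by gcongr
    _ = 2 ^ k * w i ^ k * ((1 + |t - x i|) ^ k * ‖φ (t - x i)‖) := by
        rw [mul_pow, mul_pow]; ring
    _ ≤ 2 ^ k * w i ^ k * (2 ^ k * schwartzNorm k φ) :=
        mul_le_mul_of_nonneg_left h2 (by positivity)
    _ = _ := by rw [show (4 : ℝ) = 2 * 2 by norm_num, mul_pow]; ring

/-- Each derivative produces a factor `a`, and each weight `|t|` a factor `a⁻¹`; hence both must be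
dominated by `w`. -/
theorem tameFamily_dilate (hw : ∀ i, 1 ≤ w i) {a : ι → ℝ} (ha : ∀ i, 0 < a i)
    (h1 : ∀ i, a i ≤ w i) (h2 : ∀ i, (a i)⁻¹ ≤ w i) : TameFamily w (fun i φ => dilate (a i) φ) := by
  refine tameFamily_of_deriv hw (B := fun i φ => (a i : ℂ) • SchwartzMap.derivCLM ℂ ℂ φ)
    ((tameFamily_const _).smul hw fun i => by simpa [abs_of_pos (ha i)] using h1 i)
    (fun i φ => by rw [derivCLM_dilate, map_smul]) fun k => ⟨k, 1, k, zero_le_one, fun i φ => ?_⟩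
  have hw0 : 0 ≤ w i := zero_le_one.trans (hw i)
  refine SchwartzMap.seminorm_zero_le (by positivity) fun t => ?_
  rw [dilate_apply (ha i).ne', one_mul]
  have h3 : |t| = (a i)⁻¹ * |a i * t| := by
    rw [abs_mul, abs_of_pos (ha i), inv_mul_cancel_left₀ (ha i).ne']
  calc |t| ^ k * ‖φ (a i * t)‖ = (a i)⁻¹ ^ k * (|a i * t| ^ k * ‖φ (a i * t)‖) := by
        rw [h3, mul_pow]; ring
    _ ≤ w i ^ k * schwartzNorm k φ := by
        have := (ha i).le
        gcongr
        · exact h2 i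
        · exact (SchwartzMap.le_seminorm_zero k φ _).trans
            (seminorm_le_schwartzNorm le_rfl (Nat.zero_le k) φ)

/-! ### Taylor expansion of a quadratic chirp -/

/-- The remainder of the Taylor polynomial of degree `< N` of `exp (i y)`. -/
def expRemainder (N : ℕ) (y : ℝ) : ℂ :=
  Complex.exp ((y : ℂ) * Complex.I) -
    ∑ j ∈ Finset.range N, ((y : ℂ) * Complex.I) ^ j / (j.factorial : ℂ)

/-- Differentiation lowers the order by one. Truncated subtraction keeps the formula right for `N =
0`, where the remainder is the exponential itself. -/
theorem hasDerivAt_expRemainder (N : ℕ) (y : ℝ) :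
    HasDerivAt (expRemainder N) (Complex.I * expRemainder (N - 1) y) y := by
  have h1 : HasDerivAt (fun t : ℝ => (t : ℂ) * Complex.I) (1 * Complex.I) y :=
    (Complex.ofRealCLM.hasDerivAt (x := y)).mul_const Complex.I
  have h2 : ∀ j : ℕ, HasDerivAt (fun t : ℝ => ((t : ℂ) * Complex.I) ^ j / (j.factorial : ℂ))
      ((j : ℂ) * ((y : ℂ) * Complex.I) ^ (j - 1) * (1 * Complex.I) / (j.factorial : ℂ)) y :=
    fun j => (h1.pow j).div_const _
  have h3 := h1.cexp.sub (HasDerivAt.fun_sum (u := Finset.range N) fun j _ => h2 j)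
  refine h3.congr_deriv ?_
  cases N with
  | zero => simp [expRemainder, mul_comm]
  | succ N =>
    rw [Finset.sum_range_succ', expRemainder, Nat.add_sub_cancel, mul_sub, Finset.mul_sum]
    simp only [Nat.add_sub_cancel, CharP.cast_eq_zero, zero_mul, zero_div, add_zero, one_mul]
    congr 1
    · ring
    · refine Finset.sum_congr rfl fun j _ => ?_
      rw [Nat.factorial_succ]
      have : ((j : ℂ) + 1) ≠ 0 := by exact_mod_cast Nat.succ_ne_zero j
      have : (j.factorial : ℂ) ≠ 0 := by exact_mod_cast Nat.factorial_ne_zero j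
      push_cast
      field_simp

/-- Induction with the mean value inequality on the segment from 0 to `y`; the factor `1 / N!` is
not needed. -/
theorem norm_expRemainder_le (N : ℕ) (y : ℝ) : ‖expRemainder N y‖ ≤ |y| ^ N := by
  induction N generalizing y with
  | zero => simp [expRemainder, Complex.norm_exp_ofReal_mul_I]
  | succ N ih =>
    have h := Convex.norm_image_sub_le_of_norm_hasDerivWithin_le (s := uIcc 0 y)
      (f := expRemainder (N + 1)) (f' := fun t => Complex.I * expRemainder N t) (C := |y| ^ N)
      (fun t _ => (hasDerivAt_expRemainder (N + 1) t).hasDerivWithinAt)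
      (fun t ht => by
        rw [norm_mul, Complex.norm_I, one_mul]
        have h1 : |t| ≤ |y| := by simpa using abs_sub_left_of_mem_uIcc ht
        exact (ih t).trans (by gcongr))
      (convex_uIcc 0 y) left_mem_uIcc right_mem_uIcc
    have h0 : expRemainder (N + 1) 0 = 0 := by
      simp [expRemainder, Finset.sum_range_succ']
    rw [h0, sub_zero, sub_zero, Real.norm_eq_abs] at h
    rw [pow_succ]
    exact h

/-- Multiplication by the variable. -/
def mulVar : 𝓢(ℝ, ℂ) →L[ℂ] 𝓢(ℝ, ℂ) := SchwartzMap.smulLeftCLM ℂ (fun t : ℝ => (t : ℂ))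

theorem mulVar_apply (φ : 𝓢(ℝ, ℂ)) (t : ℝ) : mulVar φ t = t * φ t := by
  rw [mulVar, SchwartzMap.smulLeftCLM_apply_apply (by fun_prop), smul_eq_mul]

/-- Multiplication by `β t + γ t²`. -/
def quadMul (β γ : ℝ) : 𝓢(ℝ, ℂ) →L[ℂ] 𝓢(ℝ, ℂ) :=
  (β : ℂ) • mulVar + (γ : ℂ) • (mulVar ∘L mulVar)

theorem quadMul_apply (β γ : ℝ) (φ : 𝓢(ℝ, ℂ)) (t : ℝ) :
    quadMul β γ φ t = ((β * t + γ * t ^ 2 : ℝ) : ℂ) * φ t := by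
  simp [quadMul, mulVar_apply]
  ring

theorem quadMul_iterate_apply (β γ : ℝ) (φ : 𝓢(ℝ, ℂ)) (j : ℕ) (t : ℝ) :
    (quadMul β γ)^[j] φ t = ((β * t + γ * t ^ 2 : ℝ) : ℂ) ^ j * φ t := by
  induction j with
  | zero => simp
  | succ j ih => rw [Function.iterate_succ_apply', quadMul_apply, ih]; ring

/-- The remainder of the Taylor expansion in `a` of `exp (i a (β t + γ t²)) φ(t)`. -/
def chirpRemainder (N : ℕ) (a β γ : ℝ) (φ : 𝓢(ℝ, ℂ)) : 𝓢(ℝ, ℂ) :=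
  chirpMul 0 (a * β) (a * γ) φ -
    ∑ j ∈ Finset.range N, (((a : ℂ) * Complex.I) ^ j / (j.factorial : ℂ)) • (quadMul β γ)^[j] φ

theorem chirpRemainder_apply (N : ℕ) (a β γ : ℝ) (φ : 𝓢(ℝ, ℂ)) (t : ℝ) :
    chirpRemainder N a β γ φ t = expRemainder N (a * (β * t + γ * t ^ 2)) * φ t := by
  simp only [chirpRemainder, sub_apply, sum_apply, smul_apply,
    chirpMul_apply, quadMul_iterate_apply, expRemainder, sub_mul, Finset.sum_mul, smul_eq_mul]
  congr 1
  · congr 4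
    ring
  · refine Finset.sum_congr rfl fun j _ => ?_
    rw [Complex.ofReal_mul, mul_pow, mul_pow, mul_pow]
    ring

/-- The term whose order drops to `N - 1` carries an explicit factor `a` that makes up for the loss.
This closes the induction on derivatives in `exists_seminorm_chirpRemainder_le`. -/
theorem derivCLM_chirpRemainder (N : ℕ) (a β γ : ℝ) (φ : 𝓢(ℝ, ℂ)) :
    SchwartzMap.derivCLM ℂ ℂ (chirpRemainder N a β γ φ) =
      chirpRemainder N a β γ (SchwartzMap.derivCLM ℂ ℂ φ) +
        ((a : ℂ) * Complex.I) •
          chirpRemainder (N - 1) a β γ ((β : ℂ) • φ + (2 * γ : ℂ) • mulVar φ) := by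
  ext t
  have hq : HasDerivAt (fun t : ℝ => a * (β * t + γ * t ^ 2)) (a * (β + γ * (2 * t))) t := by
    have := (((hasDerivAt_id t).const_mul β).add
      (((hasDerivAt_id t).pow 2).const_mul γ)).const_mul a
    simpa using! this
  have h := ((hasDerivAt_expRemainder N _).scomp t hq).mul (φ.hasDerivAt t)
  have h2 : (chirpRemainder N a β γ φ : ℝ → ℂ) =
      fun t => expRemainder N (a * (β * t + γ * t ^ 2)) * φ t :=
    funext (chirpRemainder_apply N a β γ φ)
  rw [SchwartzMap.derivCLM_apply, h2]
  refine (h.deriv).trans ?_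
  simp only [add_apply, smul_apply, chirpRemainder_apply, mulVar_apply,
    SchwartzMap.derivCLM_apply, smul_eq_mul, Complex.real_smul, Function.comp_apply]
  push_cast
  ring

/-! ### Uniform estimates for chirps and their Taylor remainders -/

theorem tameFamily_quadMul (hw : ∀ i, 1 ≤ w i) {β γ : ι → ℝ} (hβ : ∀ i, |β i| ≤ w i)
    (hγ : ∀ i, |γ i| ≤ w i) : TameFamily w (fun i φ => quadMul (β i) (γ i) φ) :=
  ((tameFamily_const mulVar).smul hw (c := fun i => (β i : ℂ)) (by simpa using hβ)).add hw
    ((tameFamily_const (mulVar ∘L mulVar)).smul hw (c := fun i => (γ i : ℂ)) (by simpa using hγ))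

theorem exists_seminorm_chirpRemainder_le (hw : ∀ i, 1 ≤ w i) {a β γ : ι → ℝ}
    (ha : ∀ i, |a i| ≤ 1) (hβ : ∀ i, |β i| ≤ w i) (hγ : ∀ i, |γ i| ≤ w i) (N k l : ℕ) :
    ∃ (K : ℕ) (C : ℝ) (b : ℕ), 0 ≤ C ∧ ∀ i φ,
      SchwartzMap.seminorm ℂ k l (chirpRemainder N (a i) (β i) (γ i) φ) ≤
        |a i| ^ N * (C * w i ^ b * schwartzNorm K φ) := by
  induction l generalizing N with
  | zero =>
    -- By `|expRemainder N y| ≤ |y|^N`, the weighted remainder is at most `|a|^N` times the same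
    -- weighted size of the `N`-th iterate of `quadMul`.
    obtain ⟨K, C, b, hC, h⟩ := (tameFamily_quadMul hw hβ hγ).iterate hw N k 0
    refine ⟨K, C, b, hC, fun i φ => ?_⟩
    have hw0 : 0 ≤ w i := zero_le_one.trans (hw i)
    refine SchwartzMap.seminorm_zero_le (by positivity) fun t => ?_
    rw [chirpRemainder_apply, norm_mul]
    have h1 := SchwartzMap.le_seminorm_zero k ((quadMul (β i) (γ i))^[N] φ) t
    rw [quadMul_iterate_apply, norm_mul, norm_pow, Complex.norm_real, Real.norm_eq_abs] at h1
    calc _ ≤ |t| ^ k * (|a i * (β i * t + γ i * t ^ 2)| ^ N * ‖φ t‖) := by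
          gcongr; exact norm_expRemainder_le _ _
      _ = |a i| ^ N * (|t| ^ k * (|β i * t + γ i * t ^ 2| ^ N * ‖φ t‖)) := by
          rw [abs_mul, mul_pow]; ring
      _ ≤ _ := mul_le_mul_of_nonneg_left (h1.trans (h i φ)) (by positivity)
  | succ l ih =>
    obtain ⟨K₁, C₁, b₁, hC₁, h₁⟩ := ih N
    obtain ⟨K₂, C₂, b₂, hC₂, h₂⟩ := ih (N - 1)
    have hT : TameFamily w (fun i φ => (β i : ℂ) • φ + (2 * γ i : ℂ) • mulVar φ) := by
      have h3 : TameFamily w (fun i φ => (γ i : ℂ) • ((2 : ℂ) • mulVar) φ) :=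
        (tameFamily_const ((2 : ℂ) • mulVar)).smul hw (by simpa using hγ)
      have h4 := ((tameFamily_const (ContinuousLinearMap.id ℂ _)).smul hw
        (c := fun i => (β i : ℂ)) (by simpa using hβ)).add hw h3
      have h5 : (fun i φ => (β i : ℂ) • φ + (2 * γ i : ℂ) • mulVar φ) = fun i φ =>
          (β i : ℂ) • ContinuousLinearMap.id ℂ 𝓢(ℝ, ℂ) φ + (γ i : ℂ) • ((2 : ℂ) • mulVar) φ := by
        funext i φ
        simp [smul_smul, mul_comm]
      rw [h5]
      exact h4
    obtain ⟨K₃, C₃, b₃, hC₃, h₃⟩ :=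
      (tameFamily_const (w := w) (SchwartzMap.derivCLM ℂ ℂ)).schwartzNorm_le hw K₁
    obtain ⟨K₄, C₄, b₄, hC₄, h₄⟩ := hT.schwartzNorm_le hw K₂
    obtain ⟨K, C, b, hC, h⟩ := exists_common_bound (n := 2) hw
      (P := fun j i φ => ![C₁ * w i ^ b₁ * (C₃ * w i ^ b₃ * schwartzNorm K₃ φ),
        C₂ * w i ^ b₂ * (C₄ * w i ^ b₄ * schwartzNorm K₄ φ)] j)
      (fun j => by
        fin_cases j
        · exact ⟨K₃, C₁ * C₃, b₁ + b₃, by positivity, fun i φ => le_of_eq (by simp; ring)⟩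
        · exact ⟨K₄, C₂ * C₄, b₂ + b₄, by positivity, fun i φ => le_of_eq (by simp; ring)⟩)
    refine ⟨K, 2 * C, b, by positivity, fun i φ => ?_⟩
    have hw0 : 0 ≤ w i := zero_le_one.trans (hw i)
    rw [SchwartzMap.seminorm_succ, derivCLM_chirpRemainder]
    refine (map_add_le_add _ _ _).trans ?_
    rw [map_smul_eq_mul, norm_mul, Complex.norm_I, mul_one, Complex.norm_real, Real.norm_eq_abs]
    -- For `N = 0` no order is lost, and `|a| ≤ 1` absorbs the extra factor.
    have hN : |a i| * |a i| ^ (N - 1) ≤ |a i| ^ N := by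
      cases N with
      | zero => simpa using ha i
      | succ N => rw [Nat.add_sub_cancel, pow_succ']
    have h5 := h 0 i φ
    have h6 := h 1 i φ
    simp only [Matrix.cons_val_zero, Matrix.cons_val_one] at h5 h6
    have hX : 0 ≤ C * w i ^ b * schwartzNorm K φ := by positivity
    calc _ ≤ |a i| ^ N * (C₁ * w i ^ b₁ * (C₃ * w i ^ b₃ * schwartzNorm K₃ φ)) +
          |a i| * (|a i| ^ (N - 1) * (C₂ * w i ^ b₂ * (C₄ * w i ^ b₄ * schwartzNorm K₄ φ))) := by
          gcongr
          · refine (h₁ i _).trans ?_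
            gcongr
            exact h₃ i φ
          · refine (h₂ i _).trans ?_
            gcongr
            exact h₄ i φ
      _ ≤ |a i| ^ N * (C * w i ^ b * schwartzNorm K φ) +
          |a i| ^ N * (C * w i ^ b * schwartzNorm K φ) := by
          rw [← mul_assoc |a i|]
          gcongr
      _ = _ := by ring

theorem tameFamily_chirpMul (hw : ∀ i, 1 ≤ w i) {β γ : ι → ℝ} (hβ : ∀ i, |β i| ≤ w i)
    (hγ : ∀ i, |γ i| ≤ w i) : TameFamily w (fun i φ => chirpMul 0 (β i) (γ i) φ) := by
  intro k l
  -- The remainder of order 0 at `a = 1` is the chirped function itself.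
  simpa [chirpRemainder] using exists_seminorm_chirpRemainder_le hw (a := fun _ => 1)
    (fun _ => by simp) hβ hγ 0 k l

end TameFamily

/-! ### Completeness of the Schwartz space and equicontinuity on the Lizorkin space -/

theorem iterate_derivCLM_apply (l : ℕ) (φ : 𝓢(ℝ, ℂ)) (t : ℝ) :
    (SchwartzMap.derivCLM ℂ ℂ ^ l) φ t = iteratedDeriv l φ t := by
  induction l generalizing φ with
  | zero => simp
  | succ l ih =>
    rw [pow_succ, mul_apply_eq_comp, ih, iteratedDeriv_succ']
    rfl

theorem CauchySeq.tendsto_seminorm_sub {u : ℕ → 𝓢(ℝ, ℂ)} (hu : CauchySeq u) (k l : ℕ) :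
    Tendsto (fun p : ℕ × ℕ => SchwartzMap.seminorm ℂ k l (u p.2 - u p.1)) atTop (𝓝 0) := by
  have h1 := cauchySeq_iff_tendsto.1 hu
  rw [uniformity_eq_comap_nhds_zero, tendsto_comap_iff] at h1
  have h2 := ((schwartz_withSeminorms ℂ ℝ ℂ).continuous_seminorm (k, l)).tendsto 0
  rw [map_zero] at h2
  exact h2.comp h1

/-- All derivatives converge uniformly with any weight `|x|^k`. The limits `g l` are successive
derivatives of `g 0`, and the weighted bounds pass to the limit. -/
theorem CauchySeq.exists_schwartz_limit {u : ℕ → 𝓢(ℝ, ℂ)} (hu : CauchySeq u) :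
    ∃ φ, Tendsto u atTop (𝓝 φ) := by
  have hk : ∀ (k l : ℕ) (ε : ℝ), 0 < ε → ∃ n₀, ∀ m ≥ n₀, ∀ n ≥ n₀, ∀ x : ℝ,
      |x| ^ k * ‖iteratedDeriv l (u n) x - iteratedDeriv l (u m) x‖ ≤ ε := by
    intro k l ε hε
    have h := (hu.tendsto_seminorm_sub k l).eventually_lt_const hε
    rw [← prod_atTop_atTop_eq] at h
    obtain ⟨n₀, hn₀⟩ := (eventually_atTop_prod_self'.1 (by rwa [prod_atTop_atTop_eq] at h))
    refine ⟨n₀, fun m hm n hn x => le_trans ?_ (hn₀ m hm n hn).le⟩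
    have h3 := SchwartzMap.le_seminorm' ℂ k l (u n - u m) x
    rwa [← iterate_derivCLM_apply, map_sub, sub_apply, iterate_derivCLM_apply,
      iterate_derivCLM_apply] at h3
  have hc : ∀ (l : ℕ) (x : ℝ), ∃ y, Tendsto (fun n => iteratedDeriv l (u n) x) atTop (𝓝 y) := by
    intro l x
    refine cauchySeq_tendsto_of_complete (Metric.cauchySeq_iff'.2 fun ε hε => ?_)
    obtain ⟨n₀, h⟩ := hk 0 l (ε / 2) (half_pos hε)
    refine ⟨n₀, fun n hn => ?_⟩
    have := h n₀ le_rfl n hn x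
    rw [pow_zero, one_mul, ← dist_eq_norm] at this
    linarith
  choose g hg using hc
  have hlim : ∀ (k l : ℕ) (ε : ℝ), 0 < ε → ∃ n₀, ∀ n ≥ n₀, ∀ x : ℝ,
      |x| ^ k * ‖iteratedDeriv l (u n) x - g l x‖ ≤ ε := by
    intro k l ε hε
    obtain ⟨n₀, h⟩ := hk k l ε hε
    refine ⟨n₀, fun n hn x => ?_⟩
    -- Here `m → ∞` in the Cauchy estimate, with `n` and `x` fixed.
    exact le_of_tendsto (((hg l x).const_sub _).norm.const_mul _)
      ((eventually_ge_atTop n₀).mono fun m hm => h m hm n hn x)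
  have hderiv : ∀ l x, HasDerivAt (g l) (g (l + 1) x) x := by
    intro l
    refine hasDerivAt_of_tendstoUniformly (l := atTop) (f := fun n => iteratedDeriv l (u n))
      (f' := fun n => iteratedDeriv (l + 1) (u n)) ?_ (Eventually.of_forall fun n x => ?_) (hg l)
    · refine Metric.tendstoUniformly_iff.2 fun ε hε => ?_
      obtain ⟨n₀, h⟩ := hlim 0 (l + 1) (ε / 2) (half_pos hε)
      filter_upwards [eventually_ge_atTop n₀] with n hn x
      have := h n hn x
      rw [pow_zero, one_mul, ← dist_eq_norm, dist_comm] at this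
      linarith
    · rw [iteratedDeriv_succ]
      have h : iteratedDeriv l (u n) = (SchwartzMap.derivCLM ℂ ℂ ^ l) (u n) :=
        funext fun t => (iterate_derivCLM_apply l _ t).symm
      rw [h]
      exact SchwartzMap.hasDerivAt _ x
  have hiter : ∀ l, iteratedDeriv l (g 0) = g l := by
    intro l
    induction l with
    | zero => simp
    | succ l ih => rw [iteratedDeriv_succ, ih]; exact funext fun x => (hderiv l x).deriv
  let φ : 𝓢(ℝ, ℂ) :=
    { toFun := g 0
      smooth' := contDiff_of_differentiable_iteratedDeriv fun l _ => by
        rw [hiter]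
        exact fun x => (hderiv l x).differentiableAt
      decay' := fun k l => by
        obtain ⟨n, h⟩ := hlim k l 1 one_pos
        refine ⟨1 + SchwartzMap.seminorm ℂ k l (u n), fun x => ?_⟩
        rw [norm_iteratedFDeriv_eq_norm_iteratedDeriv, hiter, Real.norm_eq_abs]
        have h1 := h n le_rfl x
        have h2 := SchwartzMap.le_seminorm' ℂ k l (u n) x
        have h3 : ‖g l x‖ ≤ ‖iteratedDeriv l (u n) x - g l x‖ + ‖iteratedDeriv l (u n) x‖ := by
          rw [norm_sub_rev]
          simpa using norm_add_le (g l x - iteratedDeriv l (u n) x) (iteratedDeriv l (u n) x)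
        calc _ ≤ |x| ^ k * (‖iteratedDeriv l (u n) x - g l x‖ + ‖iteratedDeriv l (u n) x‖) := by
              gcongr
          _ ≤ _ := by rw [mul_add]; exact add_le_add h1 h2 }
  refine ⟨φ, ((schwartz_withSeminorms ℂ ℝ ℂ).tendsto_nhds u φ).2 fun i ε hε => ?_⟩
  obtain ⟨n₀, h⟩ := hlim i.1 i.2 (ε / 2) (half_pos hε)
  filter_upwards [eventually_ge_atTop n₀] with n hn
  refine lt_of_le_of_lt (SchwartzMap.seminorm_le_bound' ℂ i.1 i.2 _ (half_pos hε).le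
    fun x => ?_) (half_lt_self hε)
  have h4 : iteratedDeriv i.2 φ x = g i.2 x := congrFun (hiter i.2) x
  rw [← iterate_derivCLM_apply, map_sub, sub_apply, iterate_derivCLM_apply,
    iterate_derivCLM_apply, h4]
  exact h n hn x

instance : (uniformity 𝓢(ℝ, ℂ)).IsCountablyGenerated :=
  IsUniformAddGroup.uniformity_countably_generated

instance : CompleteSpace 𝓢(ℝ, ℂ) :=
  UniformSpace.complete_of_cauchySeq_tendsto fun _ hu => hu.exists_schwartz_limit

/-- Each moment is a continuous functional on `S(ℝ)`, and the space is the intersection of their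
kernels. -/
theorem isClosed_lizorkinSpace : IsClosed (LizorkinSpace : Set 𝓢(ℝ, ℂ)) := by
  have h : (LizorkinSpace : Set 𝓢(ℝ, ℂ)) =
      ⋂ k : ℕ, {φ | SchwartzMap.integralCLM ℂ volume ((mulVar ^ k) φ) = 0} := by
    ext φ
    simp only [SetLike.mem_coe, mem_lizorkinSpace, mem_iInter, mem_ofPred_eq,
      SchwartzMap.integralCLM_apply]
    have hx : ∀ (k : ℕ) (x : ℝ), (mulVar ^ k) φ x = (x : ℂ) ^ k * φ x := by
      intro k x
      induction k with
      | zero => simp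
      | succ k ih =>
        rw [pow_succ', mul_apply_eq_comp, mulVar_apply, ih, pow_succ']
        ring
    simp_rw [hx]
  rw [h]
  exact isClosed_iInter fun k => isClosed_eq (by fun_prop) continuous_const

instance : CompleteSpace LizorkinSpace := isClosed_lizorkinSpace.completeSpace_coe

instance : (uniformity LizorkinSpace).IsCountablyGenerated := by
  rw [uniformity_subtype]
  infer_instance

instance : IsUniformAddGroup LizorkinSpace :=
  inferInstanceAs (IsUniformAddGroup LizorkinSpace.toAddSubgroup)

/-- Complete with countably generated uniformity, hence a Baire space, hence barrelled; this is what
Banach–Steinhaus requires. -/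
instance : BarrelledSpace ℂ LizorkinSpace := by
  let _ := UniformSpace.pseudoMetricSpace LizorkinSpace
  infer_instance

/-- A pointwise bounded family of Lizorkin distributions is equicontinuous. -/
theorem LizorkinDistribution.exists_uniform_bound {κ : Type*} (T : κ → LizorkinDistribution)
    (hT : ∀ φ, BddAbove (range fun n => ‖T n φ‖)) :
    ∃ (K : ℕ) (C : ℝ), 0 ≤ C ∧ ∀ n (φ : LizorkinSpace), ‖T n φ‖ ≤ C * schwartzNorm K φ := by
  have h := (norm_withSeminorms ℂ ℂ).banach_steinhaus (𝓕 := T) (fun _ φ => hT φ)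
  have h2 := (WithSeminorms.uniformEquicontinuous_iff_exists_continuous_seminorm
    (norm_withSeminorms ℂ ℂ) (fun n => (T n).toLinearMap)).1 h 0
  obtain ⟨p, hp, hpT⟩ := h2
  obtain ⟨s, C, -, hs⟩ := Seminorm.bound_of_continuous
    (LinearMap.withSeminorms_induced (schwartz_withSeminorms ℂ ℝ ℂ) LizorkinSpace.subtype) p hp
  refine ⟨s.sup (fun i => max i.1 i.2), C, C.2, fun n φ => (hpT n φ).trans ((hs φ).trans ?_)⟩
  rw [_root_.smul_apply, NNReal.smul_def, smul_eq_mul]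
  refine mul_le_mul_of_nonneg_left ?_ C.2
  refine Seminorm.finset_sup_apply_le (apply_nonneg _ _) fun i hi => ?_
  have := Finset.le_sup (f := fun i : ℕ × ℕ => max i.1 i.2) hi
  exact seminorm_le_schwartzNorm ((le_max_left _ _).trans this) ((le_max_right _ _).trans this) _

/-! ### A lower bound for slowly varying functions -/

/-- `L` agrees with a measurable function almost everywhere on `(0, A]`, and scaling by `ε`
preserves null sets; `s ≤ 1` and `ε ≤ A` keep `s ε` in that interval. -/
theorem nullMeasurableSet_lt_comp_mul {L : ℝ → ℝ} {A : ℝ}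
    (hL : AEMeasurable L (volume.restrict (Ioc 0 A))) {ε : ℝ} (hε : 0 < ε) (hεA : ε ≤ A) (c : ℝ) :
    NullMeasurableSet {s : ℝ | s ∈ Ioc (0 : ℝ) 1 ∧ c < L (s * ε)} := by
  obtain ⟨M, hM, hLM⟩ := hL
  rw [EventuallyEq, ae_restrict_iff' measurableSet_Ioc] at hLM
  have hq : Measure.QuasiMeasurePreserving (fun s : ℝ => s * ε) volume volume := by
    refine ⟨by fun_prop, ?_⟩
    rw [Real.map_volume_mul_right hε.ne']
    exact Measure.smul_absolutelyContinuous
  have h : ∀ᵐ s : ℝ, s * ε ∈ Ioc 0 A → L (s * ε) = M (s * ε) := hq.ae hLM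
  have hm : MeasurableSet {s : ℝ | s ∈ Ioc (0 : ℝ) 1 ∧ c < M (s * ε)} :=
    measurableSet_Ioc.inter
      (measurableSet_lt measurable_const (Measurable.comp hM (measurable_id.mul_const ε)))
  refine hm.nullMeasurableSet.congr ?_
  filter_upwards [h] with s hs
  refine propext (and_congr_right fun h1 => ?_)
  rw [hs ⟨mul_pos h1.1 hε, by nlinarith [h1.1, h1.2]⟩]

theorem exists_lt_volume_of_monotone_iUnion {U : ℕ → Set ℝ} (hU : Monotone U)
    (h : ⋃ n, U n = Ioc (0 : ℝ) 1) : ∃ N, ∀ n ≥ N, ENNReal.ofReal (3 / 4) < volume (U n) := by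
  have h1 : volume (⋃ n, U n) = ⨆ n, volume (U n) := hU.measure_iUnion
  rw [h, Real.volume_Ioc] at h1
  have h2 : ENNReal.ofReal (3 / 4) < ⨆ n, volume (U n) := by
    rw [← h1]
    exact (ENNReal.ofReal_lt_ofReal_iff (by norm_num)).2 (by norm_num)
  obtain ⟨N, hN⟩ := lt_iSup_iff.1 h2
  exact ⟨N, fun n hn => hN.trans_le (measure_mono (hU hn))⟩

open scoped Pointwise in
/-- A slowly varying function does not drop by a factor of more than four on `[ε / 2, ε]`. -/
theorem SlowlyVaryingAtZero.exists_quarter_le {L : ℝ → ℝ} (hL : SlowlyVaryingAtZero L) :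
    ∃ A : ℝ, 0 < A ∧ (∀ ε ∈ Ioc 0 A, 0 < L ε) ∧
      ∀ ε ∈ Ioc 0 A, ∀ s ∈ Icc (1 / 2 : ℝ) 1, L ε / 4 ≤ L (s * ε) := by
  obtain ⟨⟨A, hA, hpos, hmeas⟩, hlim⟩ := hL
  by_contra! hcon
  have hseq : ∀ n : ℕ, ∃ ε s : ℝ, ε ∈ Ioc 0 (min A (1 / (n + 1))) ∧ s ∈ Icc (1 / 2 : ℝ) 1 ∧
      L (s * ε) < L ε / 4 := by
    intro n
    obtain ⟨ε, hε, s, hs, h⟩ := hcon (min A (1 / (n + 1))) (lt_min hA (by positivity))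
      fun ε hε => hpos ε ⟨hε.1, hε.2.trans (min_le_left _ _)⟩
    exact ⟨ε, s, hε, hs, h⟩
  choose e r he hr hlt using hseq
  have he0 : ∀ n, 0 < e n := fun n => (he n).1
  have heA : ∀ n, e n ≤ A := fun n => (he n).2.trans (min_le_left _ _)
  have hr0 : ∀ n, 0 < r n := fun n => by linarith [(hr n).1]
  have het : Tendsto e atTop (𝓝[>] 0) := by
    refine tendsto_nhdsWithin_iff.2 ⟨?_, Eventually.of_forall he0⟩
    exact squeeze_zero (fun n => (he0 n).le) (fun n => (he n).2.trans (min_le_right _ _))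
      tendsto_one_div_add_atTop_nhds_zero_nat
  have hret : Tendsto (fun n => r n * e n) atTop (𝓝[>] 0) := by
    refine tendsto_nhdsWithin_iff.2 ⟨?_, Eventually.of_forall fun n => mul_pos (hr0 n) (he0 n)⟩
    refine squeeze_zero (fun n => (mul_pos (hr0 n) (he0 n)).le) (fun n => ?_)
      (tendsto_nhdsWithin_iff.1 het).1
    nlinarith [(hr n).2, he0 n]
  have hreA : ∀ n, r n * e n ≤ A := fun n => by nlinarith [(hr n).2, he0 n, heA n]
  -- By slow variation both `U n` and `V n` increase to `(0, 1]`. A common point `r s` of `U n` and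
  -- `r · V n` would give `L(e)/2 < L(s r e) < 2 L(r e) < L(e)/2`. So the two sets are disjoint in
  -- `(0, 1]`, which their measures forbid.
  let U : ℕ → Set ℝ := fun n => {s | s ∈ Ioc (0 : ℝ) 1 ∧ ∀ k ≥ n, L (e k) / 2 < L (s * e k)}
  let V : ℕ → Set ℝ := fun n =>
    {s | s ∈ Ioc (0 : ℝ) 1 ∧ ∀ k ≥ n, L (s * (r k * e k)) < 2 * L (r k * e k)}
  have hUm : Monotone U := fun n m h s hs => ⟨hs.1, fun k hk => hs.2 k (h.trans hk)⟩
  have hVm : Monotone V := fun n m h s hs => ⟨hs.1, fun k hk => hs.2 k (h.trans hk)⟩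
  have hUu : ⋃ n, U n = Ioc (0 : ℝ) 1 := by
    refine Subset.antisymm (iUnion_subset fun n s hs => hs.1) fun s hs => mem_iUnion.2 ?_
    have h := ((hlim s hs.1).comp het).eventually_const_lt (show (1 / 2 : ℝ) < 1 by norm_num)
    obtain ⟨n, hn⟩ := eventually_atTop.1 h
    refine ⟨n, hs, fun k hk => ?_⟩
    have h1 := (lt_div_iff₀ (hpos (e k) ⟨he0 k, heA k⟩)).1 (hn k hk)
    linarith
  have hVu : ⋃ n, V n = Ioc (0 : ℝ) 1 := by
    refine Subset.antisymm (iUnion_subset fun n s hs => hs.1) fun s hs => mem_iUnion.2 ?_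
    have h := ((hlim s hs.1).comp hret).eventually_lt_const (show (1 : ℝ) < 2 by norm_num)
    obtain ⟨n, hn⟩ := eventually_atTop.1 h
    exact ⟨n, hs, fun k hk =>
      (div_lt_iff₀ (hpos _ ⟨mul_pos (hr0 k) (he0 k), hreA k⟩)).1 (hn k hk)⟩
  obtain ⟨N₁, hN₁⟩ := exists_lt_volume_of_monotone_iUnion hUm hUu
  obtain ⟨N₂, hN₂⟩ := exists_lt_volume_of_monotone_iUnion hVm hVu
  set n := max N₁ N₂
  have hUnull : NullMeasurableSet (U n) := by
    have h1 : U n = Ioc (0 : ℝ) 1 ∩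
        ⋂ k : ℕ, {s | n ≤ k → s ∈ Ioc (0 : ℝ) 1 ∧ L (e k) / 2 < L (s * e k)} := by
      ext s
      simp only [U, mem_ofPred_eq, mem_inter_iff, mem_iInter]
      exact ⟨fun h => ⟨h.1, fun k hk => ⟨h.1, h.2 k hk⟩⟩, fun h => ⟨h.1, fun k hk => (h.2 k hk).2⟩⟩
    rw [h1]
    refine measurableSet_Ioc.nullMeasurableSet.inter (NullMeasurableSet.iInter fun k => ?_)
    by_cases hk : n ≤ k
    · simpa only [hk, true_imp_iff] using
        nullMeasurableSet_lt_comp_mul hmeas (he0 k) (heA k) (L (e k) / 2)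
    · simp [hk]
  have hdisj : Disjoint (U n) ((fun s => r n * s) '' V n) := by
    refine disjoint_left.2 ?_
    rintro _ hs ⟨s, hs', rfl⟩
    have h1 := hs.2 n le_rfl
    have h2 := hs'.2 n le_rfl
    have h3 := hlt n
    rw [show s * (r n * e n) = r n * s * e n by ring] at h2
    linarith
  have hsub : U n ∪ (fun s => r n * s) '' V n ⊆ Ioc (0 : ℝ) 1 := by
    rintro _ (h | ⟨s, hs, rfl⟩)
    · exact h.1
    · exact ⟨mul_pos (hr0 n) hs.1.1, mul_le_one₀ (hr n).2 hs.1.1.le hs.1.2⟩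
  have hvol := measure_mono (μ := volume) hsub
  rw [measure_union₀' hUnull hdisj.aedisjoint, Real.volume_Ioc, sub_zero] at hvol
  have hW : volume ((fun s => r n * s) '' V n) = ENNReal.ofReal (r n) * volume (V n) := by
    have h1 : (fun s => r n * s) '' V n = r n • V n := rfl
    rw [h1, Measure.addHaar_smul]
    simp [abs_of_pos (hr0 n)]
  rw [hW] at hvol
  have h1 := hN₁ n (le_max_left _ _)
  have h2 := hN₂ n (le_max_right _ _)
  -- The contradiction is `3/4 + (1/2)(3/4) = 9/8 > 1`.
  have h3 : ENNReal.ofReal (1 / 2) * ENNReal.ofReal (3 / 4) ≤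
      ENNReal.ofReal (r n) * volume (V n) :=
    mul_le_mul' (ENNReal.ofReal_le_ofReal (hr n).1) h2.le
  have h4 := (add_le_add h1.le h3).trans hvol
  rw [← ENNReal.ofReal_mul (by norm_num), ← ENNReal.ofReal_add (by norm_num) (by norm_num),
    ENNReal.ofReal_le_ofReal_iff zero_le_one] at h4
  norm_num at h4

/-- Halving the argument loses at most a factor 4, so `n` halvings lose at most `4^n`. Since `4 =
2²`, this is quadratic decay; any power would serve later. -/
theorem SlowlyVaryingAtZero.exists_sq_le {L : ℝ → ℝ} (hL : SlowlyVaryingAtZero L) :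
    ∃ A c : ℝ, 0 < A ∧ 0 < c ∧ ∀ ε ∈ Ioc 0 A, c * ε ^ 2 ≤ L ε := by
  obtain ⟨A, hA, hpos, hq⟩ := hL.exists_quarter_le
  have key : ∀ n : ℕ, ∀ ε : ℝ, A / 2 ^ n ≤ ε → ε ≤ A → L A / 4 ^ n ≤ L ε := by
    intro n
    induction n with
    | zero =>
      intro ε h1 h2
      rw [le_antisymm h2 (by simpa using h1)]
      simp
    | succ n ih =>
      intro ε h1 h2
      have hε : 0 < ε := lt_of_lt_of_le (by positivity) h1
      have hn : A / 2 ^ n ≤ 2 * ε := by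
        rw [pow_succ, ← div_div] at h1
        linarith
      -- Doubling is capped at `A` to stay where the one-step bound holds; `ε / y` still lies in
      -- `[1/2, 1]`.
      set y := min (2 * ε) A
      have hy0 : 0 < y := lt_min (by positivity) hA
      have hy := ih y (le_min hn (div_le_self hA.le (one_le_pow₀ (by norm_num)))) (min_le_right _ _)
      have h3 := hq y ⟨hy0, min_le_right _ _⟩ (ε / y)
        ⟨by rw [div_le_div_iff₀ (by norm_num) hy0]; linarith [min_le_left (2 * ε) A],
          (div_le_one hy0).2 (le_min (by linarith) h2)⟩
      rw [div_mul_cancel₀ _ hy0.ne'] at h3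
      rw [pow_succ, ← div_div]
      linarith
  have hLA := hpos A ⟨hA, le_rfl⟩
  refine ⟨A, L A / (4 * A ^ 2), hA, by positivity, fun ε hε => ?_⟩
  obtain ⟨n, hn1, hn2⟩ := exists_nat_pow_near_of_lt_one (x := ε / A) (y := 1 / 2)
    (div_pos hε.1 hA) ((div_le_one hA).2 hε.2) (by norm_num) (by norm_num)
  rw [lt_div_iff₀ hA] at hn1
  rw [div_le_iff₀ hA] at hn2
  have h := key (n + 1) ε (by rw [div_eq_inv_mul, ← one_div, ← one_div_pow]; exact hn1.le) hε.2
  refine le_trans ?_ h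
  have h5 : ε ^ 2 ≤ ((1 / 2) ^ n * A) ^ 2 := pow_le_pow_left₀ hε.1.le hn2 2
  have h6 : (((1 : ℝ) / 2) ^ n) ^ 2 = 1 / 4 ^ n := by
    rw [← pow_mul, mul_comm, pow_mul, ← one_div_pow]; norm_num
  calc L A / (4 * A ^ 2) * ε ^ 2 ≤ L A / (4 * A ^ 2) * ((1 / 2) ^ n * A) ^ 2 := by gcongr
    _ = L A / 4 ^ (n + 1) := by
      rw [mul_pow, h6, pow_succ]
      field_simp
      ring

/-! ### Dependence of wavelets on their parameters -/

theorem wavelet_eq (g : 𝓢(ℝ, ℂ)) (x : ℝ) {ξ : ℝ} (hξ : ξ ≠ 0) :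
    wavelet g x ξ = SchwartzMap.compSubConstCLM ℂ x (dilate ξ⁻¹ (conjSchwartz g)) := by
  ext t
  rw [wavelet_apply g x hξ, SchwartzMap.compSubConstCLM_apply, dilate_apply (inv_ne_zero hξ),
    conjSchwartz_apply, inv_mul_eq_div]

/-- The mean value inequality in the parameter `c`, at each fixed `t` and with weight `|t|^k`, gives
a Lipschitz bound uniform in `t`. -/
theorem tendsto_seminorm_sub_of_hasDerivAt {f f' : ℝ → 𝓢(ℝ, ℂ)} {k : ℕ} {a r M : ℝ} (hr : 0 < r)
    (hM : ∀ c ∈ Metric.ball a r, SchwartzMap.seminorm ℂ k 0 (f' c) ≤ M)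
    (h : ∀ c ∈ Metric.ball a r, ∀ t, HasDerivAt (fun c => f c t) (f' c t) c) :
    Tendsto (fun c => SchwartzMap.seminorm ℂ k 0 (f c - f a)) (𝓝 a) (𝓝 0) := by
  have hM0 : 0 ≤ M := (apply_nonneg _ _).trans (hM a (Metric.mem_ball_self hr))
  have hlip : ∀ c ∈ Metric.ball a r, SchwartzMap.seminorm ℂ k 0 (f c - f a) ≤ M * |c - a| := by
    intro c hc
    refine SchwartzMap.seminorm_zero_le (by positivity) fun t => ?_
    have h1 := Convex.norm_image_sub_le_of_norm_hasDerivWithin_le (s := Metric.ball a r)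
      (f := fun c => |t| ^ k • f c t) (f' := fun c => |t| ^ k • f' c t) (C := M)
      (fun c hc => ((h c hc t).const_smul (|t| ^ k)).hasDerivWithinAt)
      (fun c hc => by
        rw [norm_smul, norm_pow, Real.norm_eq_abs, abs_abs]
        exact (SchwartzMap.le_seminorm_zero k _ t).trans (hM c hc))
      (convex_ball a r) (Metric.mem_ball_self hr) hc
    rwa [← smul_sub, norm_smul, norm_pow, Real.norm_eq_abs, Real.norm_eq_abs, abs_abs] at h1
  have h2 : Tendsto (fun c => M * |c - a|) (𝓝 a) (𝓝 0) := by
    have : Continuous fun c => M * |c - a| := by fun_prop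
    simpa using this.tendsto a
  refine squeeze_zero' (Eventually.of_forall fun c => apply_nonneg _ _) ?_ h2
  filter_upwards [Metric.ball_mem_nhds a hr] with c hc using hlip c hc

theorem tendsto_of_tendsto_seminorm_sub {f : ℝ → 𝓢(ℝ, ℂ)} {a : ℝ}
    (h : ∀ l k, Tendsto (fun c => SchwartzMap.seminorm ℂ k l (f c - f a)) (𝓝 a) (𝓝 0)) :
    Tendsto f (𝓝 a) (𝓝 (f a)) :=
  ((schwartz_withSeminorms ℂ ℝ ℂ).tendsto_nhds f (f a)).2 fun i _ hε =>
    (h i.2 i.1).eventually_lt_const hε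

theorem continuous_compSubConst (φ : 𝓢(ℝ, ℂ)) :
    Continuous fun x => SchwartzMap.compSubConstCLM ℂ x φ := by
  refine continuous_iff_continuousAt.2 fun x => tendsto_of_tendsto_seminorm_sub fun l => ?_
  induction l generalizing φ with
  | zero =>
    intro k
    obtain ⟨K, C, b, hC, h⟩ := tameFamily_compSubConst (ι := Metric.ball x 1)
      (w := fun _ => |x| + 1) (x := fun c => c) (fun _ => by simp)
      (fun c => by
        have h1 := abs_lt.1 (Real.dist_eq (c : ℝ) x ▸ Metric.mem_ball.1 c.2)
        exact abs_le.2 ⟨by linarith [neg_abs_le x], by linarith [le_abs_self x]⟩) k 0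
    refine tendsto_seminorm_sub_of_hasDerivAt one_pos
      (f' := fun c => - SchwartzMap.compSubConstCLM ℂ c (SchwartzMap.derivCLM ℂ ℂ φ))
      (fun c hc => (map_neg_eq_map (SchwartzMap.seminorm ℂ k 0) _).trans_le (h ⟨c, hc⟩ _))
      fun c _ t => ?_
    exact (φ.hasDerivAt (t - c)).comp_const_sub t c
  | succ l ih =>
    intro k
    simpa only [SchwartzMap.seminorm_succ, map_sub, derivCLM_compSubConst] using
      ih (SchwartzMap.derivCLM ℂ ℂ φ) k

theorem continuousAt_dilate (φ : 𝓢(ℝ, ℂ)) {a : ℝ} (ha : 0 < a) :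
    ContinuousAt (fun a => dilate a φ) a := by
  refine tendsto_of_tendsto_seminorm_sub fun l => ?_
  have hpos : ∀ c ∈ Metric.ball a (a / 2), a / 2 < c ∧ c < 2 * a := by
    intro c hc
    have h1 := abs_lt.1 (Real.dist_eq c a ▸ Metric.mem_ball.1 hc)
    exact ⟨by linarith, by linarith⟩
  induction l generalizing φ with
  | zero =>
    intro k
    have hw : ∀ _ : Metric.ball a (a / 2), 1 ≤ 1 + 2 * a + (a / 2)⁻¹ := by
      intro _
      have : 0 < (a / 2)⁻¹ := by positivity
      linarith
    obtain ⟨K, C, b, hC, h⟩ := (tameFamily_const mulVar).comp hw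
      (tameFamily_dilate (ι := Metric.ball a (a / 2))
        (w := fun _ => 1 + 2 * a + (a / 2)⁻¹) (a := fun c => c) hw
        (fun c => (half_pos ha).trans (hpos c c.2).1)
        (fun c => by
          have := hpos c c.2
          have h1 : 0 < (a / 2)⁻¹ := by positivity
          linarith)
        (fun c => by
          have := inv_anti₀ (half_pos ha) (hpos c c.2).1.le
          linarith)) k 0
    refine tendsto_seminorm_sub_of_hasDerivAt (half_pos ha)
      (f' := fun c => mulVar (dilate c (SchwartzMap.derivCLM ℂ ℂ φ)))
      (fun c hc => h ⟨c, hc⟩ _) fun c hc t => ?_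
    have hc0 : c ≠ 0 := ((half_pos ha).trans (hpos c hc).1).ne'
    have h1 : HasDerivAt (fun c => φ (c * t)) (t • deriv φ (c * t)) c := by
      have := (φ.hasDerivAt (c * t)).scomp c ((hasDerivAt_id c).mul_const t)
      simpa [Function.comp_def] using this
    rw [mulVar_apply, dilate_apply hc0, SchwartzMap.derivCLM_apply, ← Complex.real_smul]
    refine h1.congr_of_eventuallyEq ?_
    filter_upwards [isOpen_ne.mem_nhds hc0] with y hy using dilate_apply hy φ t
  | succ l ih =>
    intro k
    set D := SchwartzMap.derivCLM ℂ ℂ φ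
    have h1 : ∀ c, SchwartzMap.seminorm ℂ k (l + 1) (dilate c φ - dilate a φ) ≤
        |c| * SchwartzMap.seminorm ℂ k l (dilate c D - dilate a D) +
          |c - a| * SchwartzMap.seminorm ℂ k l (dilate a D) := by
      intro c
      have h2 : (c : ℂ) • dilate c D - (a : ℂ) • dilate a D =
          (c : ℂ) • (dilate c D - dilate a D) + ((c - a : ℝ) : ℂ) • dilate a D := by
        push_cast
        module
      rw [SchwartzMap.seminorm_succ, map_sub, derivCLM_dilate, derivCLM_dilate, h2]
      refine (map_add_le_add _ _ _).trans_eq ?_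
      rw [map_smul_eq_mul, map_smul_eq_mul, Complex.norm_real, Complex.norm_real,
        Real.norm_eq_abs, Real.norm_eq_abs]
    have h3 : Tendsto (fun c => |c| * SchwartzMap.seminorm ℂ k l (dilate c D - dilate a D) +
        |c - a| * SchwartzMap.seminorm ℂ k l (dilate a D)) (𝓝 a) (𝓝 0) := by
      have h4 : Tendsto (fun c : ℝ => |c|) (𝓝 a) (𝓝 |a|) := continuous_abs.tendsto a
      have h5 : Tendsto (fun c : ℝ => |c - a|) (𝓝 a) (𝓝 0) := by
        have : Continuous fun c : ℝ => |c - a| := by fun_prop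
        simpa using this.tendsto a
      simpa using (h4.mul (ih D k)).add (h5.mul_const (SchwartzMap.seminorm ℂ k l (dilate a D)))
    exact squeeze_zero (fun c => apply_nonneg _ _) h1 h3

/-- A Carathéodory argument: continuity in `x` for fixed `ξ` and measurability in `ξ` for fixed `x`
give joint measurability. Extension by zero removes the degenerate `ξ ≤ 0`. -/
theorem measurable_clm_wavelet (F : 𝓢(ℝ, ℂ) →L[ℂ] ℂ) (g : 𝓢(ℝ, ℂ)) :
    Measurable fun p : ℝ × ℝ => if 0 < p.2 then F (wavelet g p.1 p.2) else 0 := by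
  refine measurable_uncurry_of_continuous_of_measurable
    (u := fun x ξ => if 0 < ξ then F (wavelet g x ξ) else 0) (fun ξ => ?_) fun x => ?_
  · by_cases hξ : 0 < ξ
    · simp only [hξ, if_true, wavelet_eq g _ hξ.ne']
      exact F.continuous.comp (continuous_compSubConst _)
    · simp [hξ, continuous_const]
  · refine ContinuousOn.measurable_piecewise (s := Ioi 0)
      (f := fun ξ => F (wavelet g x ξ)) (g := fun _ => 0) ?_ continuousOn_const measurableSet_Ioi
    have h : ContinuousOn (fun ξ : ℝ => F (SchwartzMap.compSubConstCLM ℂ x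
        (dilate ξ⁻¹ (conjSchwartz g)))) (Ioi 0) := by
      intro ξ hξ
      have h1 := (continuousAt_dilate (conjSchwartz g) (inv_pos.2 hξ)).comp
        (f := fun ξ : ℝ => ξ⁻¹) (continuousAt_inv₀ (ne_of_gt hξ))
      exact ((F.continuous.comp (SchwartzMap.compSubConstCLM ℂ x).continuous).continuousAt.comp
        h1).continuousWithinAt
    exact h.congr fun ξ hξ => by simp only [wavelet_eq g x (ne_of_gt hξ)]

/-! ### Integration over the half plane -/

/-- The weight `(1 + |x|) (ξ + ξ⁻¹)` on the half plane. -/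
def halfPlaneWeight (x ξ : ℝ) : ℝ := (1 + |x|) * (ξ + ξ⁻¹)

section weight

variable {x ξ : ℝ}

theorem two_le_add_inv (hξ : 0 < ξ) : 2 ≤ ξ + ξ⁻¹ := by
  have h : ξ * ξ⁻¹ = 1 := mul_inv_cancel₀ hξ.ne'
  have h2 : 0 < ξ⁻¹ := inv_pos.2 hξ
  nlinarith [sq_nonneg (ξ - ξ⁻¹)]

theorem add_inv_le_halfPlaneWeight (hξ : 0 < ξ) : ξ + ξ⁻¹ ≤ halfPlaneWeight x ξ :=
  le_mul_of_one_le_left (by positivity) (by linarith [abs_nonneg x])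

theorem one_le_halfPlaneWeight (hξ : 0 < ξ) : 1 ≤ halfPlaneWeight x ξ := by
  linarith [two_le_add_inv hξ, add_inv_le_halfPlaneWeight (x := x) hξ]

theorem abs_le_halfPlaneWeight (hξ : 0 < ξ) : |x| ≤ halfPlaneWeight x ξ := by
  have h := two_le_add_inv hξ
  rw [halfPlaneWeight]
  nlinarith [abs_nonneg x]

theorem le_halfPlaneWeight (hξ : 0 < ξ) : ξ ≤ halfPlaneWeight x ξ := by
  linarith [inv_pos.2 hξ, add_inv_le_halfPlaneWeight (x := x) hξ]

theorem inv_le_halfPlaneWeight (hξ : 0 < ξ) : ξ⁻¹ ≤ halfPlaneWeight x ξ := by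
  linarith [add_inv_le_halfPlaneWeight (x := x) hξ]

theorem sqrt_le_halfPlaneWeight (hξ : 0 < ξ) : √ξ ≤ halfPlaneWeight x ξ := by
  have h := le_halfPlaneWeight (x := x) hξ
  have h1 := one_le_halfPlaneWeight (x := x) hξ
  refine Real.sqrt_le_iff.2 ⟨by linarith, by nlinarith⟩

end weight

theorem IsHalfPlaneTest.aestronglyMeasurable {Φ : ℝ → ℝ → ℂ} (hΦ : IsHalfPlaneTest Φ) :
    AEStronglyMeasurable (fun p : ℝ × ℝ => Φ p.1 p.2)
      (volume.restrict ((univ : Set ℝ) ×ˢ Ioi (0 : ℝ))) :=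
  hΦ.smooth.continuousOn.aestronglyMeasurable (MeasurableSet.univ.prod measurableSet_Ioi)

theorem IsHalfPlaneTest.exists_weight_mul_norm_le {Φ : ℝ → ℝ → ℂ} (hΦ : IsHalfPlaneTest Φ)
    (b : ℕ) : ∃ C : ℝ, ∀ x ξ : ℝ, 0 < ξ → halfPlaneWeight x ξ ^ b * ‖Φ x ξ‖ ≤ C := by
  obtain ⟨C₁, h₁⟩ := hΦ.decay 0 0 b 0
  obtain ⟨C₂, h₂⟩ := hΦ.decay 0 0 b b
  simp only [iteratedDeriv_zero, pow_zero, one_mul, norm_mul, norm_pow, Complex.norm_real,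
    Real.norm_eq_abs] at h₁ h₂
  refine ⟨2 ^ b * 2 ^ b * (C₁ + C₂), fun x ξ hξ => ?_⟩
  have hξ' : 0 < ξ⁻¹ := inv_pos.2 hξ
  have hpow : ∀ u v : ℝ, 0 ≤ u → 0 ≤ v → (u + v) ^ b ≤ 2 ^ b * (u ^ b + v ^ b) := by
    intro u v hu hv
    calc (u + v) ^ b ≤ (2 * max u v) ^ b := by
          gcongr
          linarith [le_max_left u v, le_max_right u v]
      _ = 2 ^ b * max u v ^ b := mul_pow _ _ _
      _ ≤ 2 ^ b * (u ^ b + v ^ b) := by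
          gcongr
          rcases max_cases u v with h | h <;> rw [h.1] <;> nlinarith [pow_nonneg hu b, pow_nonneg hv b]
  have h3 := hpow 1 |x| zero_le_one (abs_nonneg x)
  have h4 := hpow ξ ξ⁻¹ hξ.le hξ'.le
  rw [one_pow] at h3
  rw [inv_pow] at h4
  calc halfPlaneWeight x ξ ^ b * ‖Φ x ξ‖ = (1 + |x|) ^ b * (ξ + ξ⁻¹) ^ b * ‖Φ x ξ‖ := by
        rw [halfPlaneWeight, mul_pow]
    _ ≤ (2 ^ b * (1 + |x| ^ b)) * (2 ^ b * (ξ ^ b + (ξ ^ b)⁻¹)) * ‖Φ x ξ‖ := by gcongr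
    _ = 2 ^ b * 2 ^ b * ((ξ ^ b + (ξ ^ b)⁻¹) * ‖Φ x ξ‖ +
          (ξ ^ b + (ξ ^ b)⁻¹) * (|x| ^ b * ‖Φ x ξ‖)) := by ring
    _ ≤ _ := by
        gcongr
        · exact h₁ x ξ hξ
        · exact h₂ x ξ hξ

theorem IsHalfPlaneTest.integrableOn_weight_mul {Φ : ℝ → ℝ → ℂ} (hΦ : IsHalfPlaneTest Φ)
    (b : ℕ) : IntegrableOn (fun p : ℝ × ℝ => halfPlaneWeight p.1 p.2 ^ b * ‖Φ p.1 p.2‖)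
      ((univ : Set ℝ) ×ˢ Ioi (0 : ℝ)) := by
  -- The spare powers of the weight dominate `(1 + x²)(1 + ξ²)`, whose inverse is integrable; two
  -- would already do.
  obtain ⟨C, hC⟩ := hΦ.exists_weight_mul_norm_le (b + 4)
  have hS : MeasurableSet ((univ : Set ℝ) ×ˢ Ioi (0 : ℝ)) := MeasurableSet.univ.prod measurableSet_Ioi
  have hint : Integrable (fun p : ℝ × ℝ => C * ((1 + p.1 ^ 2)⁻¹ * (1 + p.2 ^ 2)⁻¹)) :=
    (integrable_inv_one_add_sq.mul_prod integrable_inv_one_add_sq).const_mul C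
  refine Integrable.mono' hint.integrableOn ?_ ?_
  · refine AEStronglyMeasurable.mul (Measurable.aestronglyMeasurable ?_)
      hΦ.aestronglyMeasurable.norm
    unfold halfPlaneWeight
    fun_prop
  · refine (ae_restrict_iff' hS).2 (Eventually.of_forall fun p hp => ?_)
    have hξ : 0 < p.2 := hp.2
    have h1 := hC p.1 p.2 hξ
    set W := halfPlaneWeight p.1 p.2
    have hW := one_le_halfPlaneWeight (x := p.1) hξ
    have hpos : 0 < (1 + p.1 ^ 2) * (1 + p.2 ^ 2) := by positivity
    have h2 : (1 + p.1 ^ 2) * (1 + p.2 ^ 2) ≤ W ^ 4 := by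
      have h3 : 1 + p.1 ^ 2 ≤ (1 + |p.1|) ^ 2 := by
        nlinarith [abs_nonneg p.1, sq_abs p.1]
      have h4 : 1 + p.2 ^ 2 ≤ (p.2 + p.2⁻¹) ^ 2 := by
        have := mul_inv_cancel₀ hξ.ne'
        nlinarith [sq_nonneg p.2⁻¹]
      calc _ ≤ (1 + |p.1|) ^ 2 * (p.2 + p.2⁻¹) ^ 2 := by gcongr
        _ = W ^ 2 := (mul_pow _ _ _).symm
        _ ≤ W ^ 4 := pow_le_pow_right₀ hW (by norm_num)
    rw [Real.norm_of_nonneg (by positivity), ← mul_inv, ← div_eq_mul_inv, le_div_iff₀ hpos]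
    calc W ^ b * ‖Φ p.1 p.2‖ * ((1 + p.1 ^ 2) * (1 + p.2 ^ 2))
        ≤ W ^ b * ‖Φ p.1 p.2‖ * W ^ 4 := by gcongr
      _ = W ^ (b + 4) * ‖Φ p.1 p.2‖ := by ring
      _ ≤ C := h1

theorem halfPlanePairable_of_norm_le {H : ℝ → ℝ → ℂ} {C : ℝ} {b : ℕ}
    (hm : AEStronglyMeasurable (fun p : ℝ × ℝ => H p.1 p.2)
      (volume.restrict ((univ : Set ℝ) ×ˢ Ioi (0 : ℝ))))
    (hH : ∀ x ξ, 0 < ξ → ‖H x ξ‖ ≤ C * halfPlaneWeight x ξ ^ b) : HalfPlanePairable H := by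
  intro Φ hΦ
  refine Integrable.mono' ((hΦ.integrableOn_weight_mul b).const_mul C)
    (hm.mul hΦ.aestronglyMeasurable) ((ae_restrict_iff' (MeasurableSet.univ.prod
      measurableSet_Ioi)).2 (Eventually.of_forall fun p hp => ?_))
  rw [norm_mul, ← mul_assoc]
  exact mul_le_mul_of_nonneg_right (hH p.1 p.2 hp.2) (norm_nonneg _)

/-- Convergence of the normalized pairings of a sequence, by dominated convergence. -/
theorem tendsto_halfPlanePairing_div {H : ℕ → ℝ → ℝ → ℂ} {ρ : ℕ → ℂ} {B : ℝ → ℝ → ℂ}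
    {C : ℝ} {b : ℕ}
    (hm : ∀ᶠ n in atTop, AEStronglyMeasurable (fun p : ℝ × ℝ => H n p.1 p.2)
      (volume.restrict ((univ : Set ℝ) ×ˢ Ioi (0 : ℝ))))
    (hH : ∀ᶠ n in atTop, ∀ x ξ, 0 < ξ → ‖H n x ξ / ρ n‖ ≤ C * halfPlaneWeight x ξ ^ b)
    (hlim : ∀ x ξ, 0 < ξ → Tendsto (fun n => H n x ξ / ρ n) atTop (𝓝 (B x ξ)))
    {Φ : ℝ → ℝ → ℂ} (hΦ : IsHalfPlaneTest Φ) :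
    Tendsto (fun n => halfPlanePairing (H n) Φ / ρ n) atTop (𝓝 (halfPlanePairing B Φ)) := by
  have hS : MeasurableSet ((univ : Set ℝ) ×ˢ Ioi (0 : ℝ)) := MeasurableSet.univ.prod measurableSet_Ioi
  have h1 : ∀ n, halfPlanePairing (H n) Φ / ρ n =
      ∫ p in (univ : Set ℝ) ×ˢ Ioi (0 : ℝ), H n p.1 p.2 / ρ n * Φ p.1 p.2 := by
    intro n
    rw [halfPlanePairing, ← integral_div]
    congr 1
    funext p
    ring
  simp_rw [h1]
  refine tendsto_integral_filter_of_dominated_convergence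
    (fun p => C * (halfPlaneWeight p.1 p.2 ^ b * ‖Φ p.1 p.2‖)) ?_ ?_
    ((hΦ.integrableOn_weight_mul b).const_mul C) ?_
  · filter_upwards [hm] with n hn
    simp_rw [div_eq_mul_inv]
    exact (hn.mul_const _).mul hΦ.aestronglyMeasurable
  · filter_upwards [hH] with n hn
    refine (ae_restrict_iff' hS).2 (Eventually.of_forall fun p hp => ?_)
    rw [norm_mul, ← mul_assoc]
    exact mul_le_mul_of_nonneg_right (hn p.1 p.2 hp.2) (norm_nonneg _)
  · exact (ae_restrict_iff' hS).2 (Eventually.of_forall fun p hp =>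
      (hlim p.1 p.2 hp.2).mul_const _)

/-! ### Bounds for chirped wavelets -/

/-- The open half plane `ℝ × (0, ∞)`. -/
abbrev HalfPlane := {p : ℝ × ℝ // 0 < p.2}

/-- The half plane weight dominates `|x|`, `ξ` and `ξ⁻¹` together, which is all that translation and
dilation need. -/
theorem tameFamily_wavelet {ι : Type*} {w : ι → ℝ} {x ξ : ι → ℝ} (hξ : ∀ i, 0 < ξ i)
    (hw : ∀ i, halfPlaneWeight (x i) (ξ i) ≤ w i) :
    TameFamily w (fun i φ => SchwartzMap.compSubConstCLM ℂ (x i) (dilate (ξ i) φ)) := by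
  have hw1 : ∀ i, 1 ≤ w i := fun i => (one_le_halfPlaneWeight (hξ i)).trans (hw i)
  exact (tameFamily_compSubConst hw1 fun i => (abs_le_halfPlaneWeight (hξ i)).trans (hw i)).comp
    hw1 (tameFamily_dilate hw1 hξ (fun i => (le_halfPlaneWeight (hξ i)).trans (hw i))
      fun i => (inv_le_halfPlaneWeight (hξ i)).trans (hw i))

theorem wavelet_inv_eq (g : 𝓢(ℝ, ℂ)) (x : ℝ) {ξ : ℝ} (hξ : 0 < ξ) :
    wavelet g x ξ⁻¹ = SchwartzMap.compSubConstCLM ℂ x (dilate ξ (conjSchwartz g)) := by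
  rw [wavelet_eq g x (inv_pos.2 hξ).ne', inv_inv]

/-- If operators are bounded tamely in terms of a multiple of the half plane weight, then their
values at wavelets are bounded by a power of the half plane weight. -/
theorem TameFamily.exists_wavelet_bound {c : ℝ} (hc : 1 ≤ c) {A : HalfPlane → 𝓢(ℝ, ℂ) → 𝓢(ℝ, ℂ)}
    (hA : TameFamily (fun i => c * halfPlaneWeight i.1.1 i.1.2) A) (g : 𝓢(ℝ, ℂ)) (K : ℕ) :
    ∃ (C : ℝ) (b : ℕ), 0 ≤ C ∧ ∀ i : HalfPlane,
      schwartzNorm K (A i (wavelet g i.1.1 i.1.2⁻¹)) ≤ C * halfPlaneWeight i.1.1 i.1.2 ^ b := by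
  have hle : ∀ i : HalfPlane, halfPlaneWeight i.1.1 i.1.2 ≤ c * halfPlaneWeight i.1.1 i.1.2 :=
    fun i => le_mul_of_one_le_left (zero_le_one.trans (one_le_halfPlaneWeight i.2)) hc
  have hw : ∀ i : HalfPlane, 1 ≤ c * halfPlaneWeight i.1.1 i.1.2 :=
    fun i => (one_le_halfPlaneWeight i.2).trans (hle i)
  obtain ⟨K', C, b, hC, h⟩ := (hA.comp hw (tameFamily_wavelet (fun i => i.2) hle)).schwartzNorm_le
    hw K
  refine ⟨C * c ^ b * schwartzNorm K' (conjSchwartz g), b, by positivity, fun i => ?_⟩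
  rw [wavelet_inv_eq g _ i.2]
  refine (h i _).trans_eq ?_
  rw [mul_pow]
  ring

theorem exists_schwartzNorm_wavelet_le (g : 𝓢(ℝ, ℂ)) (K : ℕ) :
    ∃ (C : ℝ) (b : ℕ), 0 ≤ C ∧ ∀ x ξ, 0 < ξ →
      schwartzNorm K (wavelet g x ξ⁻¹) ≤ C * halfPlaneWeight x ξ ^ b := by
  obtain ⟨C, b, hC, h⟩ := (tameFamily_const (ContinuousLinearMap.id ℂ _)).exists_wavelet_bound
    le_rfl g K
  exact ⟨C, b, hC, fun x ξ hξ => h ⟨(x, ξ), hξ⟩⟩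

theorem exists_schwartzNorm_quadMul_wavelet_le (g : 𝓢(ℝ, ℂ)) (μ γ : ℝ) (j K : ℕ) :
    ∃ (C : ℝ) (b : ℕ), 0 ≤ C ∧ ∀ x ξ, 0 < ξ →
      schwartzNorm K ((quadMul (μ * ξ) γ)^[j] (wavelet g x ξ⁻¹)) ≤
        C * halfPlaneWeight x ξ ^ b := by
  have hc : 1 ≤ 1 + |μ| + |γ| := by linarith [abs_nonneg μ, abs_nonneg γ]
  have hw : ∀ i : HalfPlane, 1 ≤ (1 + |μ| + |γ|) * halfPlaneWeight i.1.1 i.1.2 :=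
    fun i => one_le_mul_of_one_le_of_one_le hc (one_le_halfPlaneWeight i.2)
  obtain ⟨C, b, hC, h⟩ := ((tameFamily_quadMul hw (β := fun i => μ * i.1.2) (γ := fun _ => γ)
    (fun i => by
      rw [abs_mul, abs_of_pos i.2]
      have := le_halfPlaneWeight (x := i.1.1) i.2
      have := i.2.le
      gcongr
      linarith [abs_nonneg γ])
    (fun i => by
      have := one_le_halfPlaneWeight (x := i.1.1) i.2
      nlinarith [abs_nonneg γ, abs_nonneg μ])).iterate hw j).exists_wavelet_bound hc g K
  exact ⟨C, b, hC, fun x ξ hξ => h ⟨(x, ξ), hξ⟩⟩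

theorem exists_schwartzNorm_chirpMul_wavelet_le (g : 𝓢(ℝ, ℂ)) (μ γ : ℝ) (K : ℕ) :
    ∃ (C : ℝ) (b : ℕ), 0 ≤ C ∧ ∀ x ξ, 0 < ξ →
      schwartzNorm K (chirpMul 0 (μ * ξ) γ (wavelet g x ξ⁻¹)) ≤ C * halfPlaneWeight x ξ ^ b := by
  have hc : 1 ≤ 1 + |μ| + |γ| := by linarith [abs_nonneg μ, abs_nonneg γ]
  have hw : ∀ i : HalfPlane, 1 ≤ (1 + |μ| + |γ|) * halfPlaneWeight i.1.1 i.1.2 :=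
    fun i => one_le_mul_of_one_le_of_one_le hc (one_le_halfPlaneWeight i.2)
  obtain ⟨C, b, hC, h⟩ := (tameFamily_chirpMul hw (β := fun i => μ * i.1.2) (γ := fun _ => γ)
    (fun i => by
      rw [abs_mul, abs_of_pos i.2]
      have := le_halfPlaneWeight (x := i.1.1) i.2
      have := i.2.le
      gcongr
      linarith [abs_nonneg γ])
    (fun i => by
      have := one_le_halfPlaneWeight (x := i.1.1) i.2
      nlinarith [abs_nonneg γ, abs_nonneg μ])).exists_wavelet_bound hc g K
  exact ⟨C, b, hC, fun x ξ hξ => h ⟨(x, ξ), hξ⟩⟩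

theorem exists_schwartzNorm_chirpRemainder_wavelet_le (g : 𝓢(ℝ, ℂ)) (μ γ : ℝ) (N K : ℕ) :
    ∃ (C : ℝ) (b : ℕ), 0 ≤ C ∧ ∀ a ∈ Ioc (0 : ℝ) 1, ∀ x ξ, 0 < ξ →
      schwartzNorm K (chirpRemainder N a (μ * ξ) γ (wavelet g x ξ⁻¹)) ≤
        a ^ N * (C * halfPlaneWeight x ξ ^ b) := by
  set c := 1 + |μ| + |γ| with hcdef
  have hc : 1 ≤ c := by linarith [abs_nonneg μ, abs_nonneg γ]
  let w : HalfPlane × Ioc (0 : ℝ) 1 → ℝ := fun i => c * halfPlaneWeight i.1.1.1 i.1.1.2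
  have hw : ∀ i, 1 ≤ w i :=
    fun i => one_le_mul_of_one_le_of_one_le hc (one_le_halfPlaneWeight i.1.2)
  -- Dividing by `a^N` makes the family tame uniformly in `a`, so `a` can join the index set while
  -- the weight depends on `(x, ξ)` only.
  have hT : TameFamily w (fun i φ => (((i.2 : ℝ) : ℂ) ^ N)⁻¹ •
      chirpRemainder N i.2 (μ * i.1.1.2) γ φ) := by
    intro k l
    obtain ⟨K, C, b, hC, h⟩ := exists_seminorm_chirpRemainder_le hw (a := fun i => (i.2 : ℝ))
      (β := fun i => μ * i.1.1.2) (γ := fun _ => γ)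
      (fun i => by rw [abs_of_pos i.2.2.1]; exact i.2.2.2)
      (fun i => by
        rw [abs_mul, abs_of_pos i.1.2]
        have := le_halfPlaneWeight (x := i.1.1.1) i.1.2
        have := i.1.2.le
        simp only [w]
        gcongr
        linarith [abs_nonneg γ])
      (fun i => by
        have := one_le_halfPlaneWeight (x := i.1.1.1) i.1.2
        simp only [w]
        nlinarith [abs_nonneg γ, abs_nonneg μ]) N k l
    refine ⟨K, C, b, hC, fun i φ => ?_⟩
    have ha : 0 < (i.2 : ℝ) ^ N := pow_pos i.2.2.1 N
    have h1 := h i φ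
    rw [abs_of_pos i.2.2.1] at h1
    rw [map_smul_eq_mul, norm_inv, norm_pow, Complex.norm_real, Real.norm_eq_abs,
      abs_of_pos i.2.2.1, inv_mul_le_iff₀ ha]
    exact h1
  obtain ⟨K', C, b, hC, h⟩ := (hT.comp hw (tameFamily_wavelet (x := fun i => i.1.1.1)
    (fun i => i.1.2) fun i => le_mul_of_one_le_left
      (zero_le_one.trans (one_le_halfPlaneWeight i.1.2)) hc)).schwartzNorm_le hw K
  refine ⟨C * c ^ b * schwartzNorm K' (conjSchwartz g), b, by positivity, fun a ha x ξ hξ => ?_⟩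
  have h1 := h (⟨(x, ξ), hξ⟩, ⟨a, ha⟩) (conjSchwartz g)
  rw [map_smul_eq_mul, norm_inv, norm_pow, Complex.norm_real, Real.norm_eq_abs,
    abs_of_pos ha.1, inv_mul_le_iff₀ (pow_pos ha.1 N)] at h1
  rw [wavelet_inv_eq g x hξ]
  refine h1.trans_eq ?_
  simp only [w, mul_pow]
  ring

/-! ### The fractional wavelet transform as a dilated pairing -/

/-- Multiplication by the variable only shifts the moments. So the Taylor polynomials of a chirp
preserve `S₀(ℝ)`, although chirps themselves need not. -/
theorem mulVar_mem {φ : 𝓢(ℝ, ℂ)} (hφ : φ ∈ LizorkinSpace) : mulVar φ ∈ LizorkinSpace := by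
  intro k
  simp_rw [mulVar_apply, ← mul_assoc, ← pow_succ]
  exact hφ (k + 1)

theorem quadMul_mem {φ : 𝓢(ℝ, ℂ)} (hφ : φ ∈ LizorkinSpace) (β γ : ℝ) :
    quadMul β γ φ ∈ LizorkinSpace :=
  LizorkinSpace.add_mem (LizorkinSpace.smul_mem _ (mulVar_mem hφ))
    (LizorkinSpace.smul_mem _ (mulVar_mem (mulVar_mem hφ)))

theorem quadMul_iterate_mem {φ : 𝓢(ℝ, ℂ)} (hφ : φ ∈ LizorkinSpace) (β γ : ℝ) (j : ℕ) :
    (quadMul β γ)^[j] φ ∈ LizorkinSpace := by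
  induction j with
  | zero => exact hφ
  | succ j ih => rw [Function.iterate_succ_apply']; exact quadMul_mem ih β γ

/-- The tempered distribution `F` as a continuous linear functional. -/
def temperedCLM (F : 𝓢'(ℝ, ℂ)) : 𝓢(ℝ, ℂ) →L[ℂ] ℂ := F

theorem temperedCLM_apply (F : 𝓢'(ℝ, ℂ)) (φ : 𝓢(ℝ, ℂ)) : temperedCLM F φ = F φ := rfl

/-- In the variable `t / ε` the window `g_{1/ε²}` at scale `1/(εξ)` becomes `g` at scale `1/ξ`, free
of `ε`, while the chirp and the modulation acquire coefficients proportional to `ε²`. -/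
theorem chirpMul_modulate_wavelet_eq (g : 𝓢(ℝ, ℂ)) (c₁ c₂ x : ℝ) {ε ξ : ℝ} (hε : 0 < ε)
    (hξ : 0 < ξ) :
    Complex.exp (((c₁ * (ε * x) ^ 2 / 2 - c₂ * ε ^ 2 * x * ξ : ℝ) : ℂ) * Complex.I) •
        chirpMul (-(c₁ * (ε * x) ^ 2 / 2)) 0 (c₁ / 2)
          (wavelet (modulate c₂ (dilate (1 / ε ^ 2) g)) (ε * x) (1 / (ε * ξ))) =
      dilate ε⁻¹ (chirpMul 0 (ε ^ 2 * (-c₂ * ξ)) (ε ^ 2 * (c₁ / 2)) (wavelet g x ξ⁻¹)) := by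
  ext t
  have hεξ : 1 / (ε * ξ) ≠ 0 := by positivity
  rw [smul_apply, smul_eq_mul, chirpMul_apply, wavelet_apply _ _ hεξ, modulate_apply,
    dilate_apply (by positivity), dilate_apply (by positivity), chirpMul_apply,
    wavelet_apply _ _ (inv_pos.2 hξ).ne', map_mul, ← mul_assoc, ← mul_assoc, ← Complex.exp_conj,
    ← Complex.exp_add, ← Complex.exp_add]
  congr 2
  · rw [map_mul, Complex.conj_ofReal, Complex.conj_I, mul_neg, ← neg_mul, ← add_mul, ← add_mul]
    congr 1
    rw [← Complex.ofReal_neg, ← Complex.ofReal_add, ← Complex.ofReal_add]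
    congr 1
    field_simp
    ring
  · congr 1
    field_simp

theorem phase_mul_frwt_eq (α : ℝ) (g : 𝓢(ℝ, ℂ)) (F : 𝓢'(ℝ, ℂ)) (c₂ x : ℝ) {ε ξ : ℝ} (hε : 0 < ε)
    (hξ : 0 < ξ) :
    Complex.exp (((Real.cot α * (ε * x) ^ 2 / 2 - c₂ * ε ^ 2 * x * ξ : ℝ) : ℂ) * Complex.I) *
        frwt α (modulate c₂ (dilate (1 / ε ^ 2) g)) F (ε * x) (1 / (ε * ξ)) =
      (√(ε * ξ) : ℂ) * temperedCLM F (dilate ε⁻¹ (chirpMul 0 (ε ^ 2 * (-c₂ * ξ))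
        (ε ^ 2 * (Real.cot α / 2)) (wavelet g x ξ⁻¹))) := by
  rw [← chirpMul_modulate_wavelet_eq g (Real.cot α) c₂ x hε hξ, map_smul, temperedCLM_apply,
    smul_eq_mul, frwt, one_div, Real.sqrt_inv, Complex.ofReal_inv, inv_inv]
  ring

theorem aestronglyMeasurable_frwt (α : ℝ) (G : 𝓢(ℝ, ℂ)) (F : 𝓢'(ℝ, ℂ)) {ε : ℝ} (hε : 0 < ε) :
    AEStronglyMeasurable (fun p : ℝ × ℝ => frwt α G F (ε * p.1) (1 / (ε * p.2)))
      (volume.restrict ((univ : Set ℝ) ×ˢ Ioi (0 : ℝ))) := by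
  have h1 := (measurable_clm_wavelet
    ((temperedCLM F) ∘L (chirpMul 0 0 (Real.cot α / 2))) G).comp
    (show Measurable fun p : ℝ × ℝ => (ε * p.1, 1 / (ε * p.2)) by fun_prop)
  have h2 : Measurable fun p : ℝ × ℝ => ((√(1 / (ε * p.2)) : ℝ) : ℂ)⁻¹ *
      Complex.exp (((-(Real.cot α * (ε * p.1) ^ 2 / 2) : ℝ) : ℂ) * Complex.I) := by fun_prop
  refine (h2.mul h1).aestronglyMeasurable.congr ((ae_restrict_iff' (MeasurableSet.univ.prod
      measurableSet_Ioi)).2 (Eventually.of_forall fun p hp => ?_))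
  have hp2 : 0 < p.2 := hp.2
  have hpos : 0 < 1 / (ε * p.2) := by positivity
  -- The part of the chirp depending on `x` is a scalar; once it is pulled out, a single fixed
  -- functional is applied to the wavelets.
  have h3 : ∀ (a c : ℝ) (φ : 𝓢(ℝ, ℂ)),
      chirpMul a 0 c φ = Complex.exp ((a : ℂ) * Complex.I) • chirpMul 0 0 c φ := by
    intro a c φ
    ext t
    rw [smul_apply, smul_eq_mul, chirpMul_apply, chirpMul_apply, ← mul_assoc, ← Complex.exp_add]
    congr 2
    push_cast
    ring
  simp only [Pi.mul_apply, Function.comp_apply, hpos, if_true, ContinuousLinearMap.comp_apply]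
  rw [frwt, h3 (-_), ← temperedCLM_apply, map_smul, smul_eq_mul, mul_assoc]

/-! ### Quasiasymptotics -/

/-- The dilated distribution `f(a x)` as an element of `S₀'(ℝ)`. -/
theorem LizorkinDistribution.exists_dilation_eq (f : LizorkinDistribution) (a : ℝ) :
    ∃ T : LizorkinDistribution, ∀ φ, T φ = f.dilation a φ := by
  let D : LizorkinSpace →L[ℂ] LizorkinSpace :=
    ((dilate a⁻¹) ∘L LizorkinSpace.subtypeL).codRestrict LizorkinSpace
      fun φ => dilate_mem φ.2 _
  exact ⟨(a : ℂ)⁻¹ • (f ∘L D), fun φ => rfl⟩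

/-- The same quantity is read in two ways: `f` at scale `aε` against `φ`, and at scale `ε` against a
dilate of `φ`. Since `L(aε)/L(ε) → 1`, the limits differ by `a^m`. -/
theorem HasQuasiasymptotics.homogeneous {f u : LizorkinDistribution} {m : ℝ} {L : ℝ → ℝ}
    (hL : SlowlyVaryingAtZero L) (hf : HasQuasiasymptotics f m L u) {a : ℝ} (ha : 0 < a)
    (φ : LizorkinSpace) : u.dilation a φ = ((a ^ m : ℝ) : ℂ) * u φ := by
  have hmul : Tendsto (fun ε : ℝ => a * ε) (𝓝[>] 0) (𝓝[>] 0) := by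
    refine tendsto_nhdsWithin_iff.2 ⟨?_, ?_⟩
    · have : Continuous fun ε : ℝ => a * ε := by fun_prop
      simpa using (this.tendsto 0).mono_left nhdsWithin_le_nhds
    · filter_upwards [self_mem_nhdsWithin] with ε hε using mul_pos ha hε
  have h1 := (hf φ).comp hmul
  have h2 := (hf ⟨dilate a⁻¹ φ, dilate_mem φ.2 _⟩).const_mul (a : ℂ)⁻¹
  have h3 : Tendsto (fun ε => (((a ^ m : ℝ) * (L (a * ε) / L ε) : ℝ) : ℂ)) (𝓝[>] 0)
      (𝓝 ((a ^ m : ℝ) : ℂ)) := by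
    have := (hL.2 a ha).const_mul (a ^ m)
    rw [mul_one] at this
    exact (Complex.continuous_ofReal.tendsto _).comp this
  refine tendsto_nhds_unique h2 ((h3.mul h1).congr' ?_)
  obtain ⟨⟨A, hA, hpos, -⟩, -⟩ := hL
  filter_upwards [self_mem_nhdsWithin, Ioc_mem_nhdsGT hA,
    hmul (Ioc_mem_nhdsGT hA)] with ε hε hεA haεA
  have hε0 : 0 < ε := hε
  have hLε := hpos ε hεA
  have hLaε := hpos _ haεA
  have hd : f.dilation (a * ε) φ = (a : ℂ)⁻¹ * f.dilation ε ⟨dilate a⁻¹ φ, dilate_mem φ.2 _⟩ := by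
    have h4 : dilate (a * ε)⁻¹ (φ : 𝓢(ℝ, ℂ)) = dilate ε⁻¹ (dilate a⁻¹ (φ : 𝓢(ℝ, ℂ))) := by
      ext t
      rw [dilate_apply (by positivity), dilate_apply (by positivity),
        dilate_apply (by positivity), mul_inv, mul_assoc]
    simp only [LizorkinDistribution.dilation, h4]
    push_cast
    rw [mul_inv, mul_assoc]
  simp only [Function.comp_apply]
  rw [hd, Real.mul_rpow ha.le hε0.le]
  have e1 : ((a ^ m : ℝ) : ℂ) ≠ 0 := by exact_mod_cast (Real.rpow_pos_of_pos ha m).ne'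
  have e2 : ((ε ^ m : ℝ) : ℂ) ≠ 0 := by exact_mod_cast (Real.rpow_pos_of_pos hε0 m).ne'
  have e3 : (L ε : ℂ) ≠ 0 := by exact_mod_cast hLε.ne'
  have e4 : (L (a * ε) : ℂ) ≠ 0 := by exact_mod_cast hLaε.ne'
  push_cast
  field_simp

/-- The power of `c` collects `c^(m+1)` from the homogeneity of `u` and `c^(-1/2)` from the
normalization of the transform. -/
theorem waveletTransform_eq {u : LizorkinDistribution} {m : ℝ} {c : ℝ} (hc : 0 < c)
    (hu : ∀ φ, u.dilation c φ = ((c ^ m : ℝ) : ℂ) * u φ) (g : LizorkinSpace) (x : ℝ) {ξ : ℝ}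
    (hξ : 0 < ξ) :
    ((1 / c ^ (m + 1 / 2) : ℝ) : ℂ) * waveletTransform g u (x * c) (c / ξ) =
      (√ξ : ℂ) * u ⟨wavelet g x ξ⁻¹, wavelet_mem g.2 _ _⟩ := by
  have h1 := hu ⟨wavelet g x ξ⁻¹, wavelet_mem g.2 _ _⟩
  have h2 : dilate c⁻¹ (wavelet g x ξ⁻¹) = wavelet g (x * c) (c / ξ) := by
    ext t
    rw [dilate_apply (by positivity), wavelet_apply _ _ (by positivity),
      wavelet_apply _ _ (by positivity)]
    congr 2
    field_simp
  simp only [LizorkinDistribution.dilation, h2] at h1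
  have hcm : ((c ^ m : ℝ) : ℂ) ≠ 0 := by exact_mod_cast (Real.rpow_pos_of_pos hc m).ne'
  have hcc : (c : ℂ) ≠ 0 := by exact_mod_cast hc.ne'
  have h3 : u ⟨wavelet g (x * c) (c / ξ), wavelet_mem g.2 _ _⟩ =
      c * (((c ^ m : ℝ) : ℂ) * u ⟨wavelet g x ξ⁻¹, wavelet_mem g.2 _ _⟩) := by
    rw [← h1, mul_inv_cancel_left₀ hcc]
  have hs : ((√c : ℝ) : ℂ) ≠ 0 := by exact_mod_cast (Real.sqrt_pos.2 hc).ne'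
  have hs2 : ((√c : ℝ) : ℂ) * ((√c : ℝ) : ℂ) = c := by
    exact_mod_cast Real.mul_self_sqrt hc.le
  rw [waveletTransform, h3, Real.sqrt_div hc.le, Real.rpow_add hc, ← Real.sqrt_eq_rpow]
  push_cast
  rw [inv_div, ← hs2]
  field_simp

/-! ### The remainder -/

/-- A tempered distribution has finite order, so dilation costs a fixed power of `ε⁻¹`, whatever its
behaviour off `S₀(ℝ)`. -/
theorem exists_norm_dilate_le (F : 𝓢(ℝ, ℂ) →L[ℂ] ℂ) :
    ∃ (K M : ℕ) (C : ℝ), 0 ≤ C ∧ ∀ ε ∈ Ioc (0 : ℝ) 1, ∀ φ,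
      ‖F (dilate ε⁻¹ φ)‖ ≤ C * (ε⁻¹) ^ M * schwartzNorm K φ := by
  obtain ⟨K, C, hC, h⟩ := exists_norm_le_schwartzNorm (G := F.toLinearMap) F.continuous
  have hw : ∀ ε : Ioc (0 : ℝ) 1, 1 ≤ (ε : ℝ)⁻¹ := fun ε => (one_le_inv₀ ε.2.1).2 ε.2.2
  obtain ⟨K', C', M, hC', h'⟩ := (tameFamily_dilate hw (a := fun ε => (ε : ℝ)⁻¹)
    (fun ε => inv_pos.2 ε.2.1) (fun ε => le_rfl)
    (fun ε => by rw [inv_inv]; exact ε.2.2.trans (hw ε))).schwartzNorm_le hw K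
  refine ⟨K', M, C * C', mul_nonneg hC hC', fun ε hε φ => (h _).trans ?_⟩
  calc _ ≤ C * (C' * (ε⁻¹) ^ M * schwartzNorm K' φ) :=
        mul_le_mul_of_nonneg_left (h' ⟨ε, hε⟩ φ) hC
    _ = _ := by ring

theorem SlowlyVaryingAtZero.exists_pow_le {L : ℝ → ℝ} (hL : SlowlyVaryingAtZero L) (m : ℝ) :
    ∃ (c : ℝ) (p : ℕ), 0 < c ∧ ∀ᶠ ε in 𝓝[>] (0 : ℝ), c * ε ^ p ≤ ε ^ m * L ε := by
  obtain ⟨A, c, hA, hc, h⟩ := hL.exists_sq_le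
  refine ⟨c, ⌈|m|⌉₊ + 2, hc, ?_⟩
  filter_upwards [Ioc_mem_nhdsGT hA, Ioc_mem_nhdsGT zero_lt_one] with ε hεA hε1
  have h1 : ε ^ ⌈|m|⌉₊ ≤ ε ^ m := by
    rw [← Real.rpow_natCast]
    exact Real.rpow_le_rpow_of_exponent_ge hε1.1 hε1.2 ((le_abs_self m).trans (Nat.le_ceil _))
  have h2 := h ε hεA
  have h3 : 0 < ε := hε1.1
  calc c * ε ^ (⌈|m|⌉₊ + 2) = ε ^ ⌈|m|⌉₊ * (c * ε ^ 2) := by ring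
    _ ≤ ε ^ m * L ε := by gcongr

theorem exists_remainder_bound (F : 𝓢(ℝ, ℂ) →L[ℂ] ℂ) (g : 𝓢(ℝ, ℂ)) (μ γ m : ℝ) {L : ℝ → ℝ}
    (hL : SlowlyVaryingAtZero L) :
    ∃ (N : ℕ) (C : ℝ) (b : ℕ), 0 < N ∧ 0 ≤ C ∧ ∀ᶠ ε : ℝ in 𝓝[>] 0, ∀ x ξ : ℝ, 0 < ξ →
      ‖(ε : ℂ)⁻¹ * F (dilate ε⁻¹ (chirpRemainder N (ε ^ 2) (μ * ξ) γ (wavelet g x ξ⁻¹))) /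
        ((ε ^ m * L ε : ℝ) : ℂ)‖ ≤ ε * (C * halfPlaneWeight x ξ ^ b) := by
  obtain ⟨K, M, C₁, hC₁, h₁⟩ := exists_norm_dilate_le F
  obtain ⟨c, p, hc, h₂⟩ := hL.exists_pow_le m
  -- `M` powers of `ε` pay for the dilation, `p` for the lower bound of `ε^m L(ε)`, one for the
  -- factor `ε⁻¹`, and one is left to tend to 0.
  set N := M + p + 2 with hN
  obtain ⟨C, b, hC, h₃⟩ := exists_schwartzNorm_chirpRemainder_wavelet_le g μ γ N K
  refine ⟨N, C₁ * C / c, b, by omega, by positivity, ?_⟩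
  filter_upwards [h₂, Ioc_mem_nhdsGT zero_lt_one] with ε h₂ hε x ξ hξ
  have hε0 : 0 < ε := hε.1
  have hW := zero_le_one.trans (one_le_halfPlaneWeight (x := x) hξ)
  have h4 := h₃ (ε ^ 2) ⟨by positivity, pow_le_one₀ hε0.le hε.2⟩ x ξ hξ
  have h5 := h₁ ε hε (chirpRemainder N (ε ^ 2) (μ * ξ) γ (wavelet g x ξ⁻¹))
  have hden : 0 < c * ε ^ p := by positivity
  rw [norm_div, norm_mul, norm_inv, Complex.norm_real, Complex.norm_real, Real.norm_eq_abs,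
    Real.norm_eq_abs, abs_of_pos hε0, abs_of_pos (hden.trans_le h₂)]
  have h6 : (ε ^ 2) ^ N ≤ ε ^ (M + p + 2) := by
    rw [← pow_mul]
    exact pow_le_pow_of_le_one hε0.le hε.2 (by omega)
  calc _ ≤ ε⁻¹ * (C₁ * (ε⁻¹) ^ M * (ε ^ (M + p + 2) * (C * halfPlaneWeight x ξ ^ b))) /
        (c * ε ^ p) := by
        gcongr
        refine h5.trans ?_
        gcongr
        refine h4.trans ?_
        gcongr
    _ = _ := by
        rw [pow_add, pow_add, inv_pow]
        field_simp

/-! ### The normalized transform -/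

/-- `F` agrees with `f` on the Taylor terms, which lie in `S₀(ℝ)`; only the remainder depends on the
choice of extension. -/
theorem dilation_taylor_eq {f : LizorkinDistribution} {F : 𝓢'(ℝ, ℂ)}
    (hF : IsTemperedExtension F f) (φ : LizorkinSpace) (N : ℕ) (a β γ ε : ℝ) :
    (ε : ℂ)⁻¹ * temperedCLM F (dilate ε⁻¹ (chirpMul 0 (a * β) (a * γ) φ)) =
      ∑ j ∈ Finset.range N, ((a : ℂ) * Complex.I) ^ j / (j.factorial : ℂ) *
          f.dilation ε ⟨(quadMul β γ)^[j] φ, quadMul_iterate_mem φ.2 β γ j⟩ +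
        (ε : ℂ)⁻¹ * temperedCLM F (dilate ε⁻¹ (chirpRemainder N a β γ φ)) := by
  have h1 : chirpMul 0 (a * β) (a * γ) (φ : 𝓢(ℝ, ℂ)) =
      ∑ j ∈ Finset.range N, (((a : ℂ) * Complex.I) ^ j / (j.factorial : ℂ)) •
        (quadMul β γ)^[j] (φ : 𝓢(ℝ, ℂ)) + chirpRemainder N a β γ φ := by
    rw [chirpRemainder]
    abel
  rw [h1, map_add, map_add, mul_add, map_sum, map_sum, Finset.mul_sum]
  congr 1
  refine Finset.sum_congr rfl fun j _ => ?_
  rw [map_smul, map_smul, smul_eq_mul, LizorkinDistribution.dilation, ← hF, temperedCLM_apply]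
  ring

/-- Explains the exponent: `3/2 = 1 + 1/2`, with 1 from the Jacobian of the dilation and `1/2` from
`√(εξ)`. -/
theorem normalization_eq {ε ξ m l : ℝ} (hε : 0 < ε) (z : ℂ) :
    (√(ε * ξ) : ℂ) * z / ((ε ^ (m + 3 / 2) * l : ℝ) : ℂ) =
      (√ξ : ℂ) * ((ε : ℂ)⁻¹ * z / ((ε ^ m * l : ℝ) : ℂ)) := by
  have h1 : ε ^ (m + 3 / 2) = ε ^ m * (ε * √ε) := by
    rw [show m + 3 / 2 = m + (1 + 1 / 2) by ring, Real.rpow_add hε, Real.rpow_add hε, Real.rpow_one,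
      ← Real.sqrt_eq_rpow]
  have hs : ((√ε : ℝ) : ℂ) ≠ 0 := by exact_mod_cast (Real.sqrt_pos.2 hε).ne'
  have he : (ε : ℂ) ≠ 0 := by exact_mod_cast hε.ne'
  rw [h1, Real.sqrt_mul hε.le]
  push_cast
  rw [← mul_div_assoc, ← mul_div_mul_left ((√ξ : ℂ) * ((ε : ℂ)⁻¹ * z)) _ (mul_ne_zero he hs)]
  congr 1
  · field_simp
  · ring

theorem exists_sum_bound {N : ℕ} {P : ℕ → ℝ → ℝ → ℝ}
    (h : ∀ j, ∃ (C : ℝ) (b : ℕ), 0 ≤ C ∧ ∀ x ξ, 0 < ξ → P j x ξ ≤ C * halfPlaneWeight x ξ ^ b) :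
    ∃ (C : ℝ) (b : ℕ), 0 ≤ C ∧ ∀ x ξ, 0 < ξ →
      ∑ j ∈ Finset.range N, P j x ξ ≤ C * halfPlaneWeight x ξ ^ b := by
  choose C b hC h using h
  refine ⟨∑ j ∈ Finset.range N, C j, (Finset.range N).sup b, Finset.sum_nonneg fun j _ => hC j,
    fun x ξ hξ => ?_⟩
  rw [Finset.sum_mul]
  refine Finset.sum_le_sum fun j hj => (h j x ξ hξ).trans ?_
  exact mul_le_mul_of_nonneg_left
    (pow_le_pow_right₀ (one_le_halfPlaneWeight hξ) (Finset.le_sup hj)) (hC j)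

/-- The pairing of `f(ε ·)` with a chirped wavelet, normalized by the quasiasymptotic scale. -/
def scaledPairing (F : 𝓢'(ℝ, ℂ)) (g : 𝓢(ℝ, ℂ)) (μ γ m : ℝ) (L : ℝ → ℝ) (ε x ξ : ℝ) : ℂ :=
  (ε : ℂ)⁻¹ * temperedCLM F (dilate ε⁻¹ (chirpMul 0 (ε ^ 2 * (μ * ξ)) (ε ^ 2 * γ)
    (wavelet g x ξ⁻¹))) / ((ε ^ m * L ε : ℝ) : ℂ)

theorem tendsto_scaledPairing {f u : LizorkinDistribution} {m : ℝ} {L : ℝ → ℝ}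
    (hL : SlowlyVaryingAtZero L) (hf : HasQuasiasymptotics f m L u) (g : LizorkinSpace)
    {F : 𝓢'(ℝ, ℂ)} (hF : IsTemperedExtension F f) (μ γ x : ℝ) {ξ : ℝ} (hξ : 0 < ξ) :
    Tendsto (fun ε => scaledPairing F g μ γ m L ε x ξ) (𝓝[>] 0)
      (𝓝 (u ⟨wavelet g x ξ⁻¹, wavelet_mem g.2 _ _⟩)) := by
  obtain ⟨N, C, b, hN, hC, hrem⟩ := exists_remainder_bound (temperedCLM F) g μ γ m hL
  -- A nonempty Taylor sum is needed, since its term `j = 0` carries the limit.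
  obtain ⟨N, rfl⟩ := Nat.exists_eq_succ_of_ne_zero hN.ne'
  set φ : LizorkinSpace := ⟨wavelet g x ξ⁻¹, wavelet_mem g.2 _ _⟩
  have hterm : ∀ j, Tendsto (fun ε : ℝ => (((ε ^ 2 : ℝ) : ℂ) * Complex.I) ^ j / (j.factorial : ℂ) *
      (f.dilation ε ⟨(quadMul (μ * ξ) γ)^[j] φ, quadMul_iterate_mem φ.2 _ _ j⟩ /
        ((ε ^ m * L ε : ℝ) : ℂ))) (𝓝[>] 0)
      (𝓝 ((0 : ℂ) ^ j / (j.factorial : ℂ) *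
        u ⟨(quadMul (μ * ξ) γ)^[j] φ, quadMul_iterate_mem φ.2 _ _ j⟩)) := by
    intro j
    refine Tendsto.mul ?_ (hf _)
    have h : Continuous fun ε : ℝ => (((ε ^ 2 : ℝ) : ℂ) * Complex.I) ^ j / (j.factorial : ℂ) := by
      fun_prop
    simpa using (h.tendsto 0).mono_left nhdsWithin_le_nhds
  have hsum := tendsto_finsetSum (Finset.range (N + 1)) fun j _ => hterm j
  have hR : Tendsto (fun ε : ℝ => (ε : ℂ)⁻¹ * temperedCLM F (dilate ε⁻¹
      (chirpRemainder (N + 1) (ε ^ 2) (μ * ξ) γ (wavelet g x ξ⁻¹))) /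
        ((ε ^ m * L ε : ℝ) : ℂ)) (𝓝[>] 0) (𝓝 0) := by
    refine squeeze_zero_norm' (hrem.mono fun ε h => h x ξ hξ) ?_
    have h : Continuous fun ε : ℝ => ε * (C * halfPlaneWeight x ξ ^ b) := by fun_prop
    simpa using (h.tendsto 0).mono_left nhdsWithin_le_nhds
  have hlim := hsum.add hR
  have h0 : ∑ j ∈ Finset.range (N + 1), (0 : ℂ) ^ j / (j.factorial : ℂ) *
      u ⟨(quadMul (μ * ξ) γ)^[j] φ, quadMul_iterate_mem φ.2 _ _ j⟩ + 0 = u φ := by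
    simp [Finset.sum_range_succ']
  rw [h0] at hlim
  refine hlim.congr fun ε => ?_
  rw [scaledPairing, dilation_taylor_eq hF φ (N + 1), add_div, Finset.sum_div]
  simp only [mul_div_assoc]
  rfl

/-- A convergent sequence is bounded over its whole range, so Banach–Steinhaus applies along `e n`.
For continuous `ε` the interval of boundedness could depend on the test function. -/
theorem exists_scaledPairing_le {f u : LizorkinDistribution} {m : ℝ} {L : ℝ → ℝ}
    (hL : SlowlyVaryingAtZero L) (hf : HasQuasiasymptotics f m L u) (g : LizorkinSpace)
    {F : 𝓢'(ℝ, ℂ)} (hF : IsTemperedExtension F f) (μ γ : ℝ) {e : ℕ → ℝ}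
    (he : Tendsto e atTop (𝓝[>] 0)) :
    ∃ (C : ℝ) (b : ℕ), 0 ≤ C ∧ ∀ᶠ n in atTop, ∀ x ξ, 0 < ξ →
      ‖scaledPairing F g μ γ m L (e n) x ξ‖ ≤ C * halfPlaneWeight x ξ ^ b := by
  obtain ⟨N, C, b, -, hC, hrem⟩ := exists_remainder_bound (temperedCLM F) g μ γ m hL
  choose T hT using fun n => f.exists_dilation_eq (e n)
  obtain ⟨K, C₁, hC₁, h₁⟩ := LizorkinDistribution.exists_uniform_bound
    (fun n => ((((e n) ^ m * L (e n) : ℝ) : ℂ))⁻¹ • T n) (fun φ => by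
      have h := ((hf φ).comp he).norm.bddAbove_range
      refine h.mono ?_
      rintro _ ⟨n, rfl⟩
      refine ⟨n, ?_⟩
      simp only [Function.comp_apply, smul_apply, smul_eq_mul, hT]
      rw [inv_mul_eq_div])
  obtain ⟨C₂, b₂, hC₂, h₂⟩ := exists_sum_bound (N := N)
    (P := fun j x ξ => schwartzNorm K ((quadMul (μ * ξ) γ)^[j] (wavelet g x ξ⁻¹)))
    fun j => exists_schwartzNorm_quadMul_wavelet_le g μ γ j K
  refine ⟨C₁ * C₂ + C, max b₂ b, by positivity, ?_⟩
  filter_upwards [he.eventually hrem, he.eventually (Ioc_mem_nhdsGT zero_lt_one)]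
    with n hn hen x ξ hξ
  have hW := one_le_halfPlaneWeight (x := x) hξ
  have hW0 := zero_le_one.trans hW
  set φ : LizorkinSpace := ⟨wavelet g x ξ⁻¹, wavelet_mem g.2 _ _⟩
  have hterm : ∀ j, ‖(((e n ^ 2 : ℝ) : ℂ) * Complex.I) ^ j / (j.factorial : ℂ) *
      (f.dilation (e n) ⟨(quadMul (μ * ξ) γ)^[j] φ, quadMul_iterate_mem φ.2 _ _ j⟩ /
        ((e n ^ m * L (e n) : ℝ) : ℂ))‖ ≤
      C₁ * schwartzNorm K ((quadMul (μ * ξ) γ)^[j] (wavelet g x ξ⁻¹)) := by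
    intro j
    have h3 := h₁ n ⟨(quadMul (μ * ξ) γ)^[j] φ, quadMul_iterate_mem φ.2 _ _ j⟩
    rw [smul_apply, hT, smul_eq_mul, inv_mul_eq_div] at h3
    rw [norm_mul]
    refine (mul_le_of_le_one_left (norm_nonneg _) ?_).trans h3
    rw [norm_div, norm_pow, norm_mul, Complex.norm_I, mul_one, Complex.norm_real,
      Complex.norm_natCast, Real.norm_of_nonneg (by positivity)]
    have h4 : (1 : ℝ) ≤ j.factorial := by exact_mod_cast Nat.one_le_iff_ne_zero.2 j.factorial_ne_zero
    exact div_le_one_of_le₀ ((pow_le_one₀ (by positivity) (pow_le_one₀ hen.1.le hen.2)).trans h4)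
      (by positivity)
  have hsplit : scaledPairing F g μ γ m L (e n) x ξ =
      ∑ j ∈ Finset.range N, (((e n ^ 2 : ℝ) : ℂ) * Complex.I) ^ j / (j.factorial : ℂ) *
        (f.dilation (e n) ⟨(quadMul (μ * ξ) γ)^[j] φ, quadMul_iterate_mem φ.2 _ _ j⟩ /
          ((e n ^ m * L (e n) : ℝ) : ℂ)) +
      (e n : ℂ)⁻¹ * temperedCLM F (dilate (e n)⁻¹
        (chirpRemainder N (e n ^ 2) (μ * ξ) γ (wavelet g x ξ⁻¹))) /
          ((e n ^ m * L (e n) : ℝ) : ℂ) := by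
    have h := dilation_taylor_eq hF φ N (e n ^ 2) (μ * ξ) γ (e n)
    rw [scaledPairing, h, add_div, Finset.sum_div]
    simp only [mul_div_assoc]
    rfl
  rw [hsplit]
  calc _ ≤ ∑ j ∈ Finset.range N,
        C₁ * schwartzNorm K ((quadMul (μ * ξ) γ)^[j] (wavelet g x ξ⁻¹)) +
          e n * (C * halfPlaneWeight x ξ ^ b) :=
        (norm_add_le _ _).trans (add_le_add ((norm_sum_le _ _).trans
          (Finset.sum_le_sum fun j _ => hterm j)) (hn x ξ hξ))
    _ ≤ C₁ * (C₂ * halfPlaneWeight x ξ ^ b₂) + 1 * (C * halfPlaneWeight x ξ ^ b) := by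
        rw [← Finset.mul_sum]
        gcongr
        · exact h₂ x ξ hξ
        · exact hen.2
    _ ≤ C₁ * (C₂ * halfPlaneWeight x ξ ^ max b₂ b) + 1 * (C * halfPlaneWeight x ξ ^ max b₂ b) := by
        gcongr
        exacts [le_max_left _ _, le_max_right _ _]
    _ = _ := by ring

theorem norm_sqrt_mul_le {x ξ C : ℝ} {b : ℕ} {z : ℂ} (hξ : 0 < ξ)
    (hz : ‖z‖ ≤ C * halfPlaneWeight x ξ ^ b) :
    ‖(√ξ : ℂ) * z‖ ≤ C * halfPlaneWeight x ξ ^ (b + 1) := by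
  have hW := zero_le_one.trans (one_le_halfPlaneWeight (x := x) hξ)
  rw [norm_mul, Complex.norm_real, Real.norm_of_nonneg (Real.sqrt_nonneg _)]
  calc _ ≤ halfPlaneWeight x ξ * (C * halfPlaneWeight x ξ ^ b) := by
        gcongr
        exact sqrt_le_halfPlaneWeight hξ
    _ = _ := by ring

theorem aestronglyMeasurable_waveletTransform (g : LizorkinSpace) (u : LizorkinDistribution)
    {c : ℝ} (hc : 0 < c) :
    AEStronglyMeasurable (fun p : ℝ × ℝ => waveletTransform g u (p.1 * c) (c / p.2))
      (volume.restrict ((univ : Set ℝ) ×ˢ Ioi (0 : ℝ))) := by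
  -- The measurability lemma concerns functionals on all of `S(ℝ)`, so `u` is extended first.
  obtain ⟨U, hU⟩ := exists_isTemperedExtension u
  have h1 := (measurable_clm_wavelet (temperedCLM U) g).comp
    (show Measurable fun p : ℝ × ℝ => (p.1 * c, c / p.2) by fun_prop)
  have h2 : Measurable fun p : ℝ × ℝ => ((√(c / p.2) : ℝ) : ℂ)⁻¹ := by fun_prop
  refine (h2.mul h1).aestronglyMeasurable.congr ((ae_restrict_iff' (MeasurableSet.univ.prod
      measurableSet_Ioi)).2 (Eventually.of_forall fun p hp => ?_))
  have hpos : 0 < c / p.2 := div_pos hc hp.2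
  simp only [Pi.mul_apply, Function.comp_apply, hpos, if_true, temperedCLM_apply]
  rw [waveletTransform, ← hU]

/-! ### The main theorem -/

theorem mainTheorem9
    (α : ℝ) (k : ℤ) (hα₁ : 2 * (k : ℝ) * Real.pi < α) (hα₂ : α < (2 * (k : ℝ) + 1 / 2) * Real.pi)
    (c₁ c₂ : ℝ) (hc₁ : c₁ = Real.cot α) (hc₂ : c₂ = 1 / Real.sin α)
    (m : ℝ) (L : ℝ → ℝ) (hL : SlowlyVaryingAtZero L)
    (f u : LizorkinDistribution) (hf : HasQuasiasymptotics f m L u)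
    (g : LizorkinSpace) (hg : g ≠ 0)
    (F : 𝓢'(ℝ, ℂ)) (hF : IsTemperedExtension F f)
    (H : ℝ → ℝ → ℝ → ℂ)
    (hH : ∀ ε x ξ : ℝ, H ε x ξ =
      Complex.exp (((c₁ * (ε * x) ^ 2 / 2 - c₂ * ε ^ 2 * x * ξ : ℝ) : ℂ) * Complex.I) *
        frwt α (modulate c₂ (dilate (1 / ε ^ 2) g)) F (ε * x) (1 / (ε * ξ)))
    (B : ℝ → ℝ → ℂ)
    (hB : ∀ x ξ : ℝ, B x ξ =
      ((1 / c₂ ^ (m + 1 / 2) : ℝ) : ℂ) * waveletTransform g u (x * c₂) (c₂ / ξ)) :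
    AsymptoticPointwise H (fun ε => ε ^ (m + 3 / 2) * L ε) B ∧
      AsymptoticInHalfPlaneDual H (fun ε => ε ^ (m + 3 / 2) * L ε) B := by
  -- Positivity of `c₂` makes it an admissible dilation factor for the homogeneity of `u`.
  have hsin : 0 < Real.sin α := by
    have h1 : Real.sin (α - k * (2 * Real.pi)) = Real.sin α := Real.sin_sub_int_mul_two_pi α k
    rw [← h1]
    exact Real.sin_pos_of_pos_of_lt_pi (by linarith) (by linarith [Real.pi_pos])
  have hc : 0 < c₂ := by rw [hc₂]; positivity
  have hHeq : ∀ ε x ξ : ℝ, 0 < ε → 0 < ξ → H ε x ξ = (√(ε * ξ) : ℂ) *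
      temperedCLM F (dilate ε⁻¹ (chirpMul 0 (ε ^ 2 * (-c₂ * ξ)) (ε ^ 2 * (c₁ / 2))
        (wavelet g x ξ⁻¹))) := by
    intro ε x ξ hε hξ
    rw [hH, hc₁, phase_mul_frwt_eq α g F c₂ x hε hξ]
  have hHdiv : ∀ ε x ξ : ℝ, 0 < ε → 0 < ξ → H ε x ξ / ((ε ^ (m + 3 / 2) * L ε : ℝ) : ℂ) =
      (√ξ : ℂ) * scaledPairing F g (-c₂) (c₁ / 2) m L ε x ξ := by
    intro ε x ξ hε hξ
    rw [hHeq ε x ξ hε hξ, normalization_eq hε]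
    rfl
  have hBeq : ∀ x ξ : ℝ, 0 < ξ →
      B x ξ = (√ξ : ℂ) * u ⟨wavelet g x ξ⁻¹, wavelet_mem g.2 _ _⟩ := by
    intro x ξ hξ
    rw [hB, waveletTransform_eq hc (hf.homogeneous hL hc) g x hξ]
  have hpt : AsymptoticPointwise H (fun ε => ε ^ (m + 3 / 2) * L ε) B := by
    intro x ξ hξ
    rw [hBeq x ξ hξ]
    refine ((tendsto_scaledPairing hL hf g hF (-c₂) (c₁ / 2) x hξ).const_mul (√ξ : ℂ)).congr' ?_
    filter_upwards [self_mem_nhdsWithin] with ε hε using (hHdiv ε x ξ hε hξ).symm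
  have hHm : ∀ ε : ℝ, 0 < ε → AEStronglyMeasurable (fun p : ℝ × ℝ => H ε p.1 p.2)
      (volume.restrict ((univ : Set ℝ) ×ˢ Ioi (0 : ℝ))) := by
    intro ε hε
    simp_rw [hH]
    refine AEStronglyMeasurable.mul (Measurable.aestronglyMeasurable (by fun_prop))
      (aestronglyMeasurable_frwt α _ F hε)
  refine ⟨hpt, fun ε hε => ?_, ?_, fun Φ hΦ => ?_⟩
  -- With `ε` fixed, polynomial growth in the weight is enough, so the chirp is estimated whole,
  -- without Taylor expansion.
  · obtain ⟨K, C, hC, h⟩ := exists_norm_le_schwartzNorm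
      (G := ((temperedCLM F) ∘L (dilate ε⁻¹)).toLinearMap)
      ((temperedCLM F) ∘L (dilate ε⁻¹)).continuous
    obtain ⟨C', b, hC', h'⟩ := exists_schwartzNorm_chirpMul_wavelet_le g (ε ^ 2 * -c₂)
      (ε ^ 2 * (c₁ / 2)) K
    refine halfPlanePairable_of_norm_le (C := √ε * (C * C')) (b := b + 1) (hHm ε hε)
      fun x ξ hξ => ?_
    rw [hHeq ε x ξ hε hξ, Real.sqrt_mul hε.le, Complex.ofReal_mul, mul_assoc, norm_mul,
      Complex.norm_real, Real.norm_of_nonneg (Real.sqrt_nonneg _), mul_assoc (√ε)]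
    refine mul_le_mul_of_nonneg_left (norm_sqrt_mul_le hξ ((h _).trans ?_)) (Real.sqrt_nonneg _)
    rw [mul_assoc C, ← mul_assoc (ε ^ 2)]
    exact mul_le_mul_of_nonneg_left (h' x ξ hξ) hC
  -- A one-element family turns the continuity of `u` into a norm bound.
  · obtain ⟨K, C, hC, h⟩ := LizorkinDistribution.exists_uniform_bound (fun _ : Unit => u)
      (fun φ => by simp)
    obtain ⟨C', b, hC', h'⟩ := exists_schwartzNorm_wavelet_le g K
    refine halfPlanePairable_of_norm_le (C := C * C') (b := b + 1) ?_ fun x ξ hξ => ?_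
    · simp_rw [hB]
      exact (aestronglyMeasurable_waveletTransform g u hc).const_mul _
    · rw [hBeq x ξ hξ]
      refine norm_sqrt_mul_le hξ ((h () _).trans ?_)
      rw [mul_assoc]
      exact mul_le_mul_of_nonneg_left (h' x ξ hξ) hC
  -- The filter at `0⁺` is countably generated, so sequences suffice; along them the uniform bound
  -- is available.
  · refine tendsto_of_seq_tendsto fun e he => ?_
    have hpos : ∀ᶠ n in atTop, 0 < e n := he.eventually self_mem_nhdsWithin
    obtain ⟨C, b, hC, h⟩ := exists_scaledPairing_le hL hf g hF (-c₂) (c₁ / 2) he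
    refine tendsto_halfPlanePairing_div (H := fun n => H (e n)) (C := C) (b := b + 1)
      (hpos.mono fun n hn => hHm _ hn) ?_ (fun x ξ hξ => (hpt x ξ hξ).comp he) hΦ
    filter_upwards [hpos, h] with n hn hbound x ξ hξ
    rw [hHdiv (e n) x ξ hn hξ]
    exact norm_sqrt_mul_le hξ (hbound x ξ hξ)

end
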